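/- Let $(M^{2n+1},\varphi,\xi,\eta,g)$ be a Sasakian manifold, i.e. a smooth manifold with a Riemannian metric $g$, a $(1,1)$-tensor field $\varphi$, a vector field $\xi$ and a one-form $\eta$ such that $\varphi^2=-\mathrm{Id}+\eta\otimes\xi$, $\eta(\xi)=1$, $g(\varphi X,\varphi Y)=g(X,Y)-\eta(X)\eta(Y)$, $d\eta(X,Y)=g(X,\varphi Y)$ and $[\varphi,\varphi]+2\,d\eta\otimes\xi=0$, where $2\,d\eta(X,Y)=X\eta(Y)-Y\eta(X)-\eta([X,Y])$ and $[\varphi,\varphi](X,Y)=\varphi^2[X,Y]+[\varphi X,\varphi Y]-\varphi[\varphi X,Y]-\varphi[X,\varphi Y]$. Let $N\subset M$ be a (possibly immersed) smooth hypersurface which is everywhere tangent to $\xi$, with the metric induced by $g$. For $y\in N$ put $$H_yN=\{X\in T_yN : X\perp\xi_y,\ \varphi X\in T_yN\},$$ so that $(HN,\varphi_{|HN})$ is the induced CR structure of CR codimension $2$ on $N$. Let $x\in N$ and let $\nu\in T_xM$ be a unit vector normal to $T_xN$. Let $\mathfrak{L}_\nu:H_xN\times H_xN\to\mathbb{R}$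 be the scalar Levi form attached to the covector $\omega=g_x(\cdot,\varphi\nu)$ on $T_xN$, i.e. $$\mathfrak{L}_\nu(X,Y)=g_x([\tilde X,\varphi\tilde Y]_x,\varphi\nu),$$ where $\tilde X,\tilde Y$ are any smooth sections of $HN$ near $x$ extending $X,Y$. Then $\varphi\nu$ is tangent to $N$ at $x$, and $$\overline{\mathrm{Ric}}(\xi_x,\varphi\nu)=\tfrac12\,\mathrm{tr}(\mathfrak{L}_\nu),$$ where $\overline{\mathrm{Ric}}(u,v)=\mathrm{tr}\bigl(w\mapsto \overline R(w,u)v\bigr)$ is the Ricci tensor of $N$, with $\overline R(X,Y)=[\overline\nabla_X,\overline\nabla_Y]-\overline\nabla_{[X,Y]}$ for the Levi-Civita connection $\overline\nabla$ of $N$, and the trace of $\mathfrak{L}_\nu$ on $H_xN$ is taken with respect to $g$. -/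

import Mathlib

open scoped Manifold ContDiff Topology Bundle

noncomputable section

namespace SasakiHypersurface

/-! ### Vector fields on a smooth manifold -/

section Basics

variable {E : Type*} [NormedAddCommGroup E] [NormedSpace ℝ E]
  {H : Type*} [TopologicalSpace H] (I : ModelWithCorners ℝ E H)
  {M : Type*} [TopologicalSpace M] [ChartedSpace H M] [IsManifold I ∞ M]

/-- The (not necessarily continuous) vector field `X` is differentiable at `x`. -/
def FieldDiffAt (X : Π x : M, TangentSpace I x) (x : M) : Prop :=
  MDifferentiableAt I I.tangent
    (fun y => (Bundle.TotalSpace.mk' E y (X y) : TangentBundle I M)) x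

/-- The vector field `X` is smooth at (that is, near) `x`. -/
def FieldSmoothAt (X : Π x : M, TangentSpace I x) (x : M) : Prop :=
  ContMDiffAt I I.tangent ∞
    (fun y => (Bundle.TotalSpace.mk' E y (X y) : TangentBundle I M)) x

/-- The derivative `X f` of the function `f` along the vector field `X`, at the point `x`. -/
def dirDeriv (X : Π x : M, TangentSpace I x) (f : M → ℝ) (x : M) : ℝ :=
  mvfderiv I f x (X x)

/-- The exterior derivative of a one-form, evaluated on the vector fields `X`, `Y` at `x`, with
the normalisation `2 dη(X, Y) = X η(Y) - Y η(X) - η([X, Y])` that is customary in contact metric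
geometry. -/
def extDeriv₁ (η : Π x : M, TangentSpace I x →L[ℝ] ℝ) (X Y : Π x : M, TangentSpace I x)
    (x : M) : ℝ :=
  (1 / 2) * (dirDeriv I X (fun y => η y (Y y)) x - dirDeriv I Y (fun y => η y (X y)) x
    - η x (VectorField.mlieBracket I X Y x))

/-- The Nijenhuis torsion
`[φ, φ](X, Y) = φ² [X, Y] + [φ X, φ Y] - φ [φ X, Y] - φ [X, φ Y]`
of a field `φ` of endomorphisms. -/
def nijenhuis (φ : Π x : M, TangentSpace I x →L[ℝ] TangentSpace I x)
    (X Y : Π x : M, TangentSpace I x) (x : M) : TangentSpace I x :=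
  φ x (φ x (VectorField.mlieBracket I X Y x))
    + VectorField.mlieBracket I (fun y => φ y (X y)) (fun y => φ y (Y y)) x
    - φ x (VectorField.mlieBracket I (fun y => φ y (X y)) Y x)
    - φ x (VectorField.mlieBracket I X (fun y => φ y (Y y)) x)

/-! ### Levi-Civita connection and Ricci tensor

Here a metric is a family `g` of functions of two tangent vectors; the definitions are used only
when `g` is a smooth Riemannian metric. -/

/-- The right-hand side of Koszul's formula for `2 g(∇_X Y, Z)`. -/
def koszul (g : Π x : M, TangentSpace I x → TangentSpace I x → ℝ)
    (X Y Z : Π x : M, TangentSpace I x) (x : M) : ℝ :=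
  dirDeriv I X (fun y => g y (Y y) (Z y)) x
    + dirDeriv I Y (fun y => g y (Z y) (X y)) x
    - dirDeriv I Z (fun y => g y (X y) (Y y)) x
    + g x (VectorField.mlieBracket I X Y x) (Z x)
    - g x (VectorField.mlieBracket I X Z x) (Y x)
    - g x (VectorField.mlieBracket I Y Z x) (X x)

open Classical in
/-- The Levi-Civita covariant derivative `∇_X Y` of the metric `g`: its value at `x` is the vector
determined by Koszul's formula. (For a smooth Riemannian metric this vector exists and is unique
whenever `X` and `Y` are differentiable at `x`; outside this range the value is irrelevant and set
to be `0` if there is no such vector.) -/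
def leviCivita (g : Π x : M, TangentSpace I x → TangentSpace I x → ℝ)
    (X Y : Π x : M, TangentSpace I x) : Π x : M, TangentSpace I x := fun x =>
  if h : ∃ w : TangentSpace I x, ∀ Z : Π x : M, TangentSpace I x, FieldDiffAt I Z x →
      2 * g x w (Z x) = koszul I g X Y Z x
  then h.choose else 0

/-- For a smooth Riemannian metric, `leviCivita` does satisfy Koszul's formula. -/
theorem koszul_leviCivita [FiniteDimensional ℝ E]
    (g : Π x : M, TangentSpace I x →L[ℝ] TangentSpace I x →L[ℝ] ℝ)
    (hs : ∀ x u v, g x u v = g x v u) (hp : ∀ x u, u ≠ 0 → 0 < g x u u)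
    (hd : ∀ x X Y, FieldDiffAt I X x → FieldDiffAt I Y x →
      MDifferentiableAt I 𝓘(ℝ, ℝ) (fun y => g y (X y) (Y y)) x)
    (X Y : Π x : M, TangentSpace I x) (x : M) (hX : FieldDiffAt I X x) (hY : FieldDiffAt I Y x)
    (Z : Π x : M, TangentSpace I x) (hZ : FieldDiffAt I Z x) :
    2 * g x (leviCivita I (fun x u v => g x u v) X Y x) (Z x)
      = koszul I (fun x u v => g x u v) X Y Z x := by
  have : IsManifold I 2 M := inferInstance
  have : IsManifold I 1 M := inferInstance
  have : CompleteSpace E := FiniteDimensional.complete ℝ E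
  have T : TensorialAt I E (fun Z : Π x : M, TangentSpace I x => koszul I (fun x u v => g x u v) X Y Z x) x := by
    constructor
    · intro f Z hf hZ
      have h1 := hd x Y Z hY hZ
      have h2 := hd x Z X hZ hX
      have e1 : (fun y => g y (Y y) ((f • Z) y)) = f * (fun y => g y (Y y) (Z y)) := by
        ext y; simp
      have e2 : (fun y => g y ((f • Z) y) (X y)) = f * (fun y => g y (Z y) (X y)) := by
        ext y; simp
      simp only [koszul, dirDeriv]
      rw [e1, e2, mvfderiv_mul hf h1, mvfderiv_mul hf h2,
        VectorField.mlieBracket_smul_right hf hZ, VectorField.mlieBracket_smul_right hf hZ]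
      simp
      rw [hs x (Z x) (Y x), hs x (Z x) (X x)]
      ring
    · intro Z Z' hZ hZ'
      have e1 : (fun y => g y (Y y) ((Z + Z') y)) = (fun y => g y (Y y) (Z y)) + (fun y => g y (Y y) (Z' y)) := by
        ext y; simp
      have e2 : (fun y => g y ((Z + Z') y) (X y)) = (fun y => g y (Z y) (X y)) + (fun y => g y (Z' y) (X y)) := by
        ext y; simp
      simp only [koszul, dirDeriv]
      rw [e1, e2, mvfderiv_add (hd x Y Z hY hZ) (hd x Y Z' hY hZ'), mvfderiv_add (hd x Z X hZ hX) (hd x Z' X hZ' hX),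
        VectorField.mlieBracket_add_right hZ hZ', VectorField.mlieBracket_add_right hZ hZ']
      simp
      ring
  have hex : ∃ w : TangentSpace I x, ∀ Z : Π x : M, TangentSpace I x, FieldDiffAt I Z x →
      2 * g x w (Z x) = koszul I (fun x u v => g x u v) X Y Z x := by
    let L := TensorialAt.mkHom _ x T
    have : FiniteDimensional ℝ (TangentSpace I x) := inferInstanceAs (FiniteDimensional ℝ E)
    let A : TangentSpace I x →ₗ[ℝ] Module.Dual ℝ (TangentSpace I x) :=
      { toFun := fun u => (g x u : TangentSpace I x →ₗ[ℝ] ℝ), map_add' := by intro a b; ext; simp, map_smul' := by intro a b; ext; simp }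
    have inj : Function.Injective A := by
      rw [← LinearMap.ker_eq_bot, LinearMap.ker_eq_bot']
      intro u hu
      by_contra h
      have := hp x u h
      have h2 : g x u u = 0 := by simpa [A] using congrArg (fun f => f u) hu
      linarith
    have surj : Function.Surjective A := (LinearMap.injective_iff_surjective_of_finrank_eq_finrank (Subspace.dual_finrank_eq).symm).1 inj
    obtain ⟨w, hw⟩ := surj ((1/2 : ℝ) • (L : TangentSpace I x →ₗ[ℝ] ℝ))
    refine ⟨w, fun Z hZ => ?_⟩
    have h3 : g x w (Z x) = 1/2 * L (Z x) := by simpa [A] using congrArg (fun f => f (Z x)) hw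
    rw [h3, TensorialAt.mkHom_apply T hZ]; ring
  unfold leviCivita
  rw [dif_pos hex]
  exact hex.choose_spec Z hZ

/-- The Riemann curvature
`R(X, Y) Z = ∇_X ∇_Y Z - ∇_Y ∇_X Z - ∇_{[X, Y]} Z` of the Levi-Civita connection of `g`. -/
def curvature (g : Π x : M, TangentSpace I x → TangentSpace I x → ℝ)
    (X Y Z : Π x : M, TangentSpace I x) : Π x : M, TangentSpace I x := fun x =>
  leviCivita I g X (leviCivita I g Y Z) x - leviCivita I g Y (leviCivita I g X Z) x
    - leviCivita I g (VectorField.mlieBracket I X Y) Z x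

end Basics

open Classical in
/-- The trace, with respect to the scalar product `g`, of a bilinear form `B` on the finite
dimensional subspace `W`: the sum `∑ B(e_i, e_i)` over a `g`-orthonormal basis `(e_i)` of `W`.
(For bilinear `B` the sum does not depend on the basis.) -/
def metricTrace {V : Type*} [AddCommGroup V] [Module ℝ V] (g : V → V → ℝ) (W : Submodule ℝ V)
    (B : V → V → ℝ) : ℝ :=
  if h : ∃ e : Fin (Module.finrank ℝ W) → V,
      (∀ i, e i ∈ W) ∧ ∀ i j, g (e i) (e j) = if i = j then 1 else 0
  then ∑ i, B (h.choose i) (h.choose i) else 0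

section Ricci

variable {E : Type*} [NormedAddCommGroup E] [NormedSpace ℝ E]
  {H : Type*} [TopologicalSpace H] (I : ModelWithCorners ℝ E H)
  {M : Type*} [TopologicalSpace M] [ChartedSpace H M] [IsManifold I ∞ M]

/-- The Ricci tensor `Ric(u, v) = ∑ g(R(e_i, u) v, e_i)` of the metric `g` at `x`. The tangent
vectors are extended to smooth vector fields near `x` in order to evaluate the curvature; by
tensoriality the choice of the extensions is immaterial. -/
def ricci (g : Π x : M, TangentSpace I x → TangentSpace I x → ℝ) (x : M)
    (u v : TangentSpace I x) : ℝ :=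
  metricTrace (g x) ⊤ fun w z =>
    g x (curvature I g (FiberBundle.extend E w) (FiberBundle.extend E u)
      (FiberBundle.extend E v) x) z

/-! ### Levi forms of CR structures -/

open Classical in
/-- The scalar Levi form `𝔏_θ(X, Y) = θ([X', J Y']_x)` at `x` of a distribution `D` with a field `J`
of complex structures on it, where `X'`, `Y'` are arbitrary smooth local sections of `D` extending
`X, Y ∈ D_x`, and `θ` is a covector at `x` annihilating `D_x`. Only the values of `J` on `D`
matter. (For a CR structure such sections exist, and the value does not depend on them.) -/
def scalarLeviForm (D : Π x : M, Submodule ℝ (TangentSpace I x))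
    (J : Π x : M, TangentSpace I x → TangentSpace I x) (x : M)
    (θ : TangentSpace I x →L[ℝ] ℝ) (X Y : TangentSpace I x) : ℝ :=
  if h : ∃ F : (Π x : M, TangentSpace I x) × (Π x : M, TangentSpace I x),
      FieldSmoothAt I F.1 x ∧ FieldSmoothAt I F.2 x ∧
      (∀ᶠ y in 𝓝 x, F.1 y ∈ D y ∧ F.2 y ∈ D y) ∧ F.1 x = X ∧ F.2 x = Y
  then θ (VectorField.mlieBracket I h.choose.1 (fun y => J y (h.choose.2 y)) x) else 0

end Ricci

/-! ### Sasakian manifolds -/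

/-- A Sasakian structure `(φ, ξ, η, g)` on a smooth manifold `M` of dimension `2n+1`: a normal
contact metric structure. -/
structure SasakianStructure (n : ℕ) (M : Type*) [TopologicalSpace M]
    [ChartedSpace (EuclideanSpace ℝ (Fin (2 * n + 1))) M]
    [IsManifold (𝓡 (2 * n + 1)) ∞ M] where
  /-- the Riemannian metric -/
  g : Bundle.ContMDiffRiemannianMetric (𝓡 (2 * n + 1)) ∞ (EuclideanSpace ℝ (Fin (2 * n + 1)))
    (fun x : M => TangentSpace (𝓡 (2 * n + 1)) x)
  /-- the structure endomorphism -/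
  φ : Π x : M, TangentSpace (𝓡 (2 * n + 1)) x →L[ℝ] TangentSpace (𝓡 (2 * n + 1)) x
  /-- the Reeb vector field -/
  ξ : Π x : M, TangentSpace (𝓡 (2 * n + 1)) x
  /-- the contact form -/
  η : Π x : M, TangentSpace (𝓡 (2 * n + 1)) x →L[ℝ] ℝ
  smooth_φ : ∀ (x : M) (X : Π x : M, TangentSpace (𝓡 (2 * n + 1)) x),
    FieldSmoothAt (𝓡 (2 * n + 1)) X x →
      FieldSmoothAt (𝓡 (2 * n + 1)) (fun y => φ y (X y)) x
  smooth_ξ : ∀ x : M, FieldSmoothAt (𝓡 (2 * n + 1)) ξ x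
  smooth_η : ∀ (x : M) (X : Π x : M, TangentSpace (𝓡 (2 * n + 1)) x),
    FieldSmoothAt (𝓡 (2 * n + 1)) X x →
      ContMDiffAt (𝓡 (2 * n + 1)) 𝓘(ℝ, ℝ) ∞ (fun y => η y (X y)) x
  φ_sq : ∀ (x : M) (v : TangentSpace (𝓡 (2 * n + 1)) x), φ x (φ x v) = -v + η x v • ξ x
  η_ξ : ∀ x : M, η x (ξ x) = 1
  compatible : ∀ (x : M) (u v : TangentSpace (𝓡 (2 * n + 1)) x),
    g.inner x (φ x u) (φ x v) = g.inner x u v - η x u * η x v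
  contact : ∀ (x : M) (X Y : Π x : M, TangentSpace (𝓡 (2 * n + 1)) x),
    FieldSmoothAt (𝓡 (2 * n + 1)) X x → FieldSmoothAt (𝓡 (2 * n + 1)) Y x →
      extDeriv₁ (𝓡 (2 * n + 1)) η X Y x = g.inner x (X x) (φ x (Y x))
  normal : ∀ (x : M) (X Y : Π x : M, TangentSpace (𝓡 (2 * n + 1)) x),
    FieldSmoothAt (𝓡 (2 * n + 1)) X x → FieldSmoothAt (𝓡 (2 * n + 1)) Y x →
      nijenhuis (𝓡 (2 * n + 1)) φ X Y x
        + (2 * extDeriv₁ (𝓡 (2 * n + 1)) η X Y x) • ξ x = 0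

/-! ### Hypersurfaces of a Sasakian manifold -/

section Hypersurface

variable {n : ℕ} {M : Type*} [TopologicalSpace M]
  [ChartedSpace (EuclideanSpace ℝ (Fin (2 * n + 1))) M] [IsManifold (𝓡 (2 * n + 1)) ∞ M]
  {N : Type*} [TopologicalSpace N]
  [ChartedSpace (EuclideanSpace ℝ (Fin (2 * n))) N] [IsManifold (𝓡 (2 * n)) ∞ N]

/-- The smooth map `i` from the `2n`-dimensional manifold `N` to the `(2n+1)`-dimensional manifold
`M` is an immersion (it has injective differentials), that is, it presents `N` as an (immersed) hypersurface of `M`. This covers the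
inclusion maps of embedded hypersurfaces. -/
structure IsHypersurface (i : N → M) : Prop where
  smooth : ContMDiff (𝓡 (2 * n)) (𝓡 (2 * n + 1)) ∞ i
  injective_mfderiv : ∀ y : N,
    Function.Injective (mfderiv (𝓡 (2 * n)) (𝓡 (2 * n + 1)) i y)

variable (S : SasakianStructure n M) (i : N → M)

/-- The Riemannian metric induced on the hypersurface. -/
def inducedMetric (y : N) (u v : TangentSpace (𝓡 (2 * n)) y) : ℝ :=
  S.g.inner (i y) (mfderiv (𝓡 (2 * n)) (𝓡 (2 * n + 1)) i y u)
    (mfderiv (𝓡 (2 * n)) (𝓡 (2 * n + 1)) i y v)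

/-- The subspace `H_y N` of the vectors `X` tangent to `N` such that `X ⊥ ξ` and `φ X` is tangent
to `N`. -/
def holTangent (y : N) : Submodule ℝ (TangentSpace (𝓡 (2 * n)) y) where
  carrier := {X | S.g.inner (i y) (mfderiv (𝓡 (2 * n)) (𝓡 (2 * n + 1)) i y X) (S.ξ (i y)) = 0 ∧
    ∃ Z : TangentSpace (𝓡 (2 * n)) y, mfderiv (𝓡 (2 * n)) (𝓡 (2 * n + 1)) i y Z
      = S.φ (i y) (mfderiv (𝓡 (2 * n)) (𝓡 (2 * n + 1)) i y X)}
  zero_mem' := ⟨by simp, 0, by simp⟩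
  add_mem' := by
    rintro X Y ⟨hX, Z, hZ⟩ ⟨hY, W, hW⟩
    exact ⟨by simp [map_add, hX, hY], Z + W, by simp only [map_add, hZ, hW]⟩
  smul_mem' := by
    rintro c X ⟨hX, Z, hZ⟩
    exact ⟨by simp [map_smul, hX], c • Z, by simp only [map_smul, hZ]⟩

open Classical in
/-- The restriction of `φ` to `HN`: `J X` is the tangent vector of `N` whose image in the tangent
space of `M` is `φ X`. (It is set to be `0` if `φ X` is not tangent to `N`.) -/
def holJ (y : N) (X : TangentSpace (𝓡 (2 * n)) y) : TangentSpace (𝓡 (2 * n)) y :=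
  if h : ∃ Z : TangentSpace (𝓡 (2 * n)) y, mfderiv (𝓡 (2 * n)) (𝓡 (2 * n + 1)) i y Z
      = S.φ (i y) (mfderiv (𝓡 (2 * n)) (𝓡 (2 * n + 1)) i y X)
  then h.choose else 0

/-- The covector `θ(X) = g(X, φ ν)` on the tangent space of `N` at `y`. -/
def normalCovector (y : N) (ν : TangentSpace (𝓡 (2 * n + 1)) (i y)) :
    TangentSpace (𝓡 (2 * n)) y →L[ℝ] ℝ :=
  (S.g.inner (i y) (S.φ (i y) ν)).comp (mfderiv (𝓡 (2 * n)) (𝓡 (2 * n + 1)) i y)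

/-- The scalar Levi form `𝔏_ν` on `H_y N` of the CR structure `(HN, φ|HN)`, attached to the covector
`θ = g(·, φ ν)`. -/
def leviForm (y : N) (ν : TangentSpace (𝓡 (2 * n + 1)) (i y))
    (X Y : TangentSpace (𝓡 (2 * n)) y) : ℝ :=
  scalarLeviForm (𝓡 (2 * n)) (holTangent S i) (holJ S i) y (normalCovector S i y ν) X Y

end Hypersurface

end SasakiHypersurface

end

noncomputable section

namespace SasakiHypersurface

set_option linter.unusedSectionVars false

/-! ### Differentiating functions along vector fields -/

section Basics

variable {E : Type*} [NormedAddCommGroup E] [NormedSpace ℝ E]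
  {H : Type*} [TopologicalSpace H] {I : ModelWithCorners ℝ E H}
  {M : Type*} [TopologicalSpace M] [ChartedSpace H M] [IsManifold I ∞ M]

/-! Let A be the covariant derivative of ξ on N and let U be the tangent vector of N with image φν.
On a Sasakian manifold the flow of ξ preserves η and, by normality, φ; hence it also preserves g =
dη(φ·,·) + η ⊗ η (`dirDeriv_ξ_inner`), and Koszul's formula reduces to ∇ξ = -φ (`koszul_ξ`).
Koszul's expression is unchanged under an isometric immersion (`koszul_inducedForm`), so A is minus
the tangential part of φ (`inner_nabla_reeb`) and no second fundamental form is needed. Thus A is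
skew, that is, ξ is Killing on N. Moreover A kills ξ, and it kills U because φ²ν = -ν is normal. It
takes values in HN, which is the orthogonal complement of ξ and U, and on HN it equals -J, so A² =
-1 there.

A Killing field preserves the Levi-Civita connection, which gives R(W, ξ)Y = (∇_W A)Y
(`curvature_killing`). Hence Ric(ξ, U) is the trace of Q(v, w) = g((∇_v A)U, w), and Q(v, w) =
-g((∇_v A)w, U) because ∇A is skew too. This vanishes on (U, U) by skewness and on (ξ, ξ) because Aξ
= 0, so only the trace over HN remains.

For sections of HN write JY = -AY and X = -A(AX), and expand [X, JY] by torsion-freeness. Terms in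
the image of A are orthogonal to U, and what is left is 𝔏(X, Y) = Q(X, Y) + Q(AY, AX)
(`leviForm_eq`). Since A is an orthogonal complex structure on HN, both summands have the same trace
(`sum_complexStructure_eq`); this is where the factor 1/2 comes from. -/

lemma mvfderiv_eq_fderiv_extChartAt [I.Boundaryless] {f : M → ℝ} {x y : M}
    (hy : y ∈ (extChartAt I x).source) (hf : MDifferentiableAt I 𝓘(ℝ, ℝ) f y)
    (v : TangentSpace I y) :
    mvfderiv I f y v = fderiv ℝ (f ∘ (extChartAt I x).symm) (extChartAt I x y)
      (mfderiv I 𝓘(ℝ, E) (extChartAt I x) y v) := by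
  have : IsManifold I 1 M := inferInstance
  have h1 : MDifferentiableAt I 𝓘(ℝ, E) (extChartAt I x) y :=
    mdifferentiableAt_extChartAt (by simpa using hy)
  have hz : extChartAt I x y ∈ (extChartAt I x).target := (extChartAt I x).map_source hy
  have h2 : MDifferentiableAt 𝓘(ℝ, E) I (extChartAt I x).symm (extChartAt I x y) := by
    have := (contMDiffWithinAt_extChartAt_symm_range (n := 1) x hz)
    rw [I.range_eq_univ, contMDiffWithinAt_univ] at this
    exact this.mdifferentiableAt one_ne_zero
  have h3 : MDifferentiableAt 𝓘(ℝ, E) 𝓘(ℝ, ℝ) (f ∘ (extChartAt I x).symm) (extChartAt I x y) := by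
    refine MDifferentiableAt.comp (extChartAt I x y) (g := f) (I' := I) ?_ h2
    rwa [(extChartAt I x).left_inv hy]
  have e : f =ᶠ[𝓝 y] (f ∘ (extChartAt I x).symm) ∘ (extChartAt I x) := by
    filter_upwards [(isOpen_extChartAt_source x).mem_nhds hy] with z hz
    exact congrArg f ((extChartAt I x).left_inv hz).symm
  have e2 : mfderiv I 𝓘(ℝ, ℝ) f y = (mfderiv 𝓘(ℝ, E) 𝓘(ℝ, ℝ) (f ∘ (extChartAt I x).symm)
      (extChartAt I x y)).comp (mfderiv I 𝓘(ℝ, E) (extChartAt I x) y) := by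
    rw [← mfderiv_comp y h3 h1]
    exact e.mfderiv_eq
  rw [mfderiv_eq_fderiv] at e2
  exact congrArg (fun L => L v) e2

variable {X Y Z : Π x : M, TangentSpace I x} {x : M}

/-- The Lie derivative of functions along a Lie bracket is the commutator of Lie derivatives. -/
theorem dirDeriv_mlieBracket [I.Boundaryless] [CompleteSpace E] {f : M → ℝ}
    (hf : ContMDiffAt I 𝓘(ℝ, ℝ) 2 f x) (hX : FieldDiffAt I X x) (hY : FieldDiffAt I Y x) :
    dirDeriv I (VectorField.mlieBracket I X Y) f x
      = dirDeriv I X (dirDeriv I Y f) x - dirDeriv I Y (dirDeriv I X f) x := by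
  have : IsManifold I 1 M := inferInstance
  have i2 : IsManifold I 2 M := inferInstance
  set φ := extChartAt I x with hφ
  have hxs : x ∈ φ.source := mem_extChartAt_source x
  have ht : φ.target ∈ 𝓝 (φ x) := by
    have := extChartAt_target_mem_nhdsWithin (I := I) x
    rwa [I.range_eq_univ, nhdsWithin_univ] at this
  let f' : E → ℝ := f ∘ φ.symm
  have hsymm : ContMDiffAt 𝓘(ℝ, E) I 2 φ.symm (φ x) := by
    have := (contMDiffWithinAt_extChartAt_symm_range (n := 2) x (mem_extChartAt_target (I := I) x))
    rwa [I.range_eq_univ, contMDiffWithinAt_univ] at this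
  have hf' : ContDiffAt ℝ 2 f' (φ x) := by
    have : ContMDiffAt 𝓘(ℝ, E) 𝓘(ℝ, ℝ) 2 f' (φ x) := by
      refine ContMDiffAt.comp (φ x) (g := f) (I' := I) ?_ hsymm
      rwa [φ.left_inv hxs]
    exact this.contDiffAt
  have hfe : ∀ᶠ y in 𝓝 x, MDifferentiableAt I 𝓘(ℝ, ℝ) f y := by
    filter_upwards [(contMDiffAt_iff_contMDiffAt_nhds (by simp)).1 hf] with y hy
      using ContMDiffAt.mdifferentiableAt hy (by simp)
  have key : ∀ W : Π x : M, TangentSpace I x, FieldDiffAt I W x →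
      ∃ W' : E → E, DifferentiableAt ℝ W' (φ x) ∧
        W' =ᶠ[𝓝 (φ x)] VectorField.mpullbackWithin 𝓘(ℝ, E) I φ.symm W (Set.range I) ∧
        ∀ y ∈ φ.source, W' (φ y) = mfderiv I 𝓘(ℝ, E) φ y (W y) := by
    intro W hW
    -- `W` read in the chart. It agrees with the pullback of `W` under the inverse chart, whose
    -- differentiability is available and in terms of which the Lie bracket is defined.
    let G : M → E := fun y => mfderiv I 𝓘(ℝ, E) φ y (W y)
    have e : ∀ z ∈ φ.target, G (φ.symm z)
        = VectorField.mpullbackWithin 𝓘(ℝ, E) I φ.symm W (Set.range I) z := by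
      intro z hz
      rw [VectorField.mpullbackWithin_apply]
      have a := mfderivWithin_extChartAt_symm_comp_mfderiv_extChartAt (I := I) hz
      have b := mfderiv_extChartAt_comp_mfderivWithin_extChartAt_symm (I := I) hz
      rw [ContinuousLinearMap.inverse_eq a b]
      rfl
    refine ⟨G ∘ φ.symm, ?_, ?_, ?_⟩
    · have h0 := MDifferentiableWithinAt.differentiableWithinAt_mpullbackWithin_vectorField
        (I := I) (V := W) (s := Set.univ) (x := x) (mdifferentiableWithinAt_univ.2 hW)
      rw [Set.preimage_univ, I.range_eq_univ, Set.univ_inter] at h0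
      refine (differentiableWithinAt_univ.1 h0).congr_of_eventuallyEq ?_
      filter_upwards [ht] with z hz
      have := e z hz
      rw [I.range_eq_univ] at this
      exact this
    · filter_upwards [ht] with z hz using e z hz
    · intro y hy
      change G (φ.symm (φ y)) = G y
      rw [φ.left_inv hy]
  have key2 : ∀ W : Π x : M, TangentSpace I x, ∀ W' : E → E,
      DifferentiableAt ℝ W' (φ x) → (∀ y ∈ φ.source, W' (φ y) = mfderiv I 𝓘(ℝ, E) φ y (W y)) →
      MDifferentiableAt I 𝓘(ℝ, ℝ) (dirDeriv I W f) x ∧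
      dirDeriv I W f ∘ φ.symm =ᶠ[𝓝 (φ x)] fun z => fderiv ℝ f' z (W' z) := by
    intro W W' hW' hWW
    have e1 : dirDeriv I W f =ᶠ[𝓝 x] (fun z => fderiv ℝ f' z (W' z)) ∘ φ := by
      filter_upwards [hfe, (isOpen_extChartAt_source x).mem_nhds hxs] with y hy hys
      simp only [dirDeriv, Function.comp]
      rw [mvfderiv_eq_fderiv_extChartAt hys hy, hWW y hys]
    constructor
    · refine MDifferentiableAt.congr_of_eventuallyEq ?_ e1
      refine MDifferentiableAt.comp x (I' := 𝓘(ℝ, E)) ?_ (mdifferentiableAt_extChartAt (by simp))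
      rw [mdifferentiableAt_iff_differentiableAt]
      refine DifferentiableAt.clm_apply ?_ hW'
      exact (hf'.fderiv_right (m := 1) (by norm_num)).differentiableAt one_ne_zero
    · have c : ContinuousAt φ.symm (φ x) := hsymm.continuousAt
      have c' : Filter.Tendsto φ.symm (𝓝 (φ x)) (𝓝 x) := by
        have := c.tendsto; rwa [φ.left_inv hxs] at this
      filter_upwards [c'.eventually e1, ht] with z hz hzt
      simp only [Function.comp] at hz ⊢
      rw [hz, φ.right_inv hzt]
  obtain ⟨X', hX', eX, pX⟩ := key X hX
  obtain ⟨Y', hY', eY, pY⟩ := key Y hY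
  obtain ⟨mX, qX⟩ := key2 X X' hX' pX
  obtain ⟨mY, qY⟩ := key2 Y Y' hY' pY
  have hbr : mfderiv I 𝓘(ℝ, E) φ x (VectorField.mlieBracket I X Y x)
      = VectorField.lieBracket ℝ X' Y' (φ x) := by
    rw [← VectorField.mlieBracketWithin_univ, VectorField.mlieBracketWithin_apply]
    have hinv := isInvertible_mfderiv_extChartAt (I := I) hxs
    obtain ⟨e, he⟩ := hinv
    rw [← hφ, ← he, ContinuousLinearMap.inverse_equiv]
    rw [Set.preimage_univ, I.range_eq_univ, Set.univ_inter]
    rw [I.range_eq_univ] at eX eY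
    refine (e.apply_symm_apply _).trans ?_
    refine Eq.trans ?_ (eX.lieBracket_vectorField_eq eY).symm
    exact congrFun VectorField.lieBracketWithin_univ (φ x)
  unfold dirDeriv at mX mY qX qY ⊢
  rw [mvfderiv_eq_fderiv_extChartAt hxs (hf.mdifferentiableAt (by simp)),
    mvfderiv_eq_fderiv_extChartAt hxs mX, mvfderiv_eq_fderiv_extChartAt hxs mY]
  rw [← hφ, hbr, ← pX x hxs, ← pY x hxs]
  rw [qX.fderiv_eq, qY.fderiv_eq]
  -- What remains is the identity in the model space, that is, the symmetry of the second derivative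
  -- of `f'`; hence the C² assumption.
  exact VectorField.fderiv_apply_lieBracket (n := 2) hf' (by simp) hY' hX'

end Basics

/-! ### Smooth vector fields, local frames -/

section Fields

variable {E : Type*} [NormedAddCommGroup E] [NormedSpace ℝ E]
  {H : Type*} [TopologicalSpace H] {I : ModelWithCorners ℝ E H}
  {M : Type*} [TopologicalSpace M] [ChartedSpace H M] [IsManifold I ∞ M]
  {X Y Z : Π x : M, TangentSpace I x} {x : M}

lemma two_le_infty : (2 : WithTop ℕ∞) ≤ ∞ :=
  WithTop.coe_le_coe.2 (le_top : (2 : ℕ∞) ≤ ⊤)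

lemma FieldSmoothAt.fieldDiffAt (h : FieldSmoothAt I X x) : FieldDiffAt I X x :=
  ContMDiffAt.mdifferentiableAt h (by simp)

/-- Being C^∞ at a point gives C^k on a neighbourhood that may shrink with k, so smoothness at
nearby points cannot be claimed. Identities that are to be differentiated are therefore proved for
merely differentiable fields. -/
lemma FieldSmoothAt.eventually_fieldDiffAt (h : FieldSmoothAt I X x) :
    ∀ᶠ y in 𝓝 x, FieldDiffAt I X y := by
  have : IsManifold I 1 M := inferInstance
  have : IsManifold I (1 + 1) M := by norm_num; infer_instance
  have h1 : ContMDiffAt I I.tangent 1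
      (fun y => (Bundle.TotalSpace.mk' E y (X y) : TangentBundle I M)) x :=
    ContMDiffAt.of_le h (by exact_mod_cast le_top)
  have : IsManifold I.tangent 1 (TangentBundle I M) := inferInstance
  filter_upwards [(contMDiffAt_iff_contMDiffAt_nhds (by simp)).1 h1] with y hy
  exact ContMDiffAt.mdifferentiableAt hy (by simp)

lemma eventually_mdifferentiableAt {f : M → ℝ} (h : ContMDiffAt I 𝓘(ℝ, ℝ) ∞ f x) :
    ∀ᶠ y in 𝓝 x, MDifferentiableAt I 𝓘(ℝ, ℝ) f y := by
  have : IsManifold I 1 M := inferInstance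
  have h1 : ContMDiffAt I 𝓘(ℝ, ℝ) 1 f x := ContMDiffAt.of_le h (by exact_mod_cast le_top)
  filter_upwards [(contMDiffAt_iff_contMDiffAt_nhds (by simp)).1 h1] with y hy
  exact ContMDiffAt.mdifferentiableAt hy (by simp)

lemma FieldDiffAt.add (hX : FieldDiffAt I X x) (hY : FieldDiffAt I Y x) :
    FieldDiffAt I (fun y => X y + Y y) x := mdifferentiableAt_add_section hX hY

lemma FieldDiffAt.neg (hX : FieldDiffAt I X x) : FieldDiffAt I (fun y => - X y) x :=
  mdifferentiableAt_neg_section hX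

lemma FieldDiffAt.smul {f : M → ℝ} (hf : MDifferentiableAt I 𝓘(ℝ, ℝ) f x)
    (hX : FieldDiffAt I X x) : FieldDiffAt I (fun y => f y • X y) x :=
  MDifferentiableAt.smul_section hf hX

lemma FieldSmoothAt.congr (hX : FieldSmoothAt I X x) (h : ∀ᶠ y in 𝓝 x, X y = Y y) :
    FieldSmoothAt I Y x :=
  ContMDiffAt.congr_of_eventuallyEq hX (h.mono fun y hy => by simp only [hy])

lemma FieldDiffAt.congr (hX : FieldDiffAt I X x) (h : ∀ᶠ y in 𝓝 x, X y = Y y) :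
    FieldDiffAt I Y x :=
  MDifferentiableAt.congr_of_eventuallyEq hX (h.mono fun y hy => by simp only [hy])

lemma fieldSmoothAt_extend (v : TangentSpace I x) :
    FieldSmoothAt I (FiberBundle.extend E v) x := FiberBundle.contMDiffAt_extend I E v

lemma FieldSmoothAt.mlieBracket [CompleteSpace E] (hX : FieldSmoothAt I X x)
    (hY : FieldSmoothAt I Y x) : FieldSmoothAt I (VectorField.mlieBracket I X Y) x := by
  have : IsManifold I ((⊤ : ℕ∞) + 1) M := by
    have : ((⊤ : ℕ∞) : WithTop ℕ∞) + 1 = ∞ := rfl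
    rw [this]; infer_instance
  have : IsManifold I (minSmoothness ℝ 2) M := by
    rw [minSmoothness_of_isRCLikeNormedField]; infer_instance
  have h : minSmoothness ℝ (((⊤ : ℕ∞) : WithTop ℕ∞) + 1) ≤ ((⊤ : ℕ∞) : WithTop ℕ∞) := by
    rw [minSmoothness_of_isRCLikeNormedField]; rfl
  exact ContMDiffAt.mlieBracket_vectorField (m := ⊤) (n := ⊤) hX hY h

lemma mlieBracket_jacobi [CompleteSpace E] (hX : FieldSmoothAt I X x)
    (hY : FieldSmoothAt I Y x) (hZ : FieldSmoothAt I Z x) :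
    VectorField.mlieBracket I X (VectorField.mlieBracket I Y Z) x
      = VectorField.mlieBracket I (VectorField.mlieBracket I X Y) Z x
        + VectorField.mlieBracket I Y (VectorField.mlieBracket I X Z) x := by
  have e : ∀ k : WithTop ℕ∞, minSmoothness ℝ k = k := fun k =>
    minSmoothness_of_isRCLikeNormedField
  have : IsManifold I (minSmoothness ℝ 3) M := by rw [e]; infer_instance
  apply VectorField.leibniz_identity_mlieBracket_apply
  · rw [e]; exact ContMDiffAt.of_le hX two_le_infty
  · rw [e]; exact ContMDiffAt.of_le hY two_le_infty
  · rw [e]; exact ContMDiffAt.of_le hZ two_le_infty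

lemma dirDeriv_congr {f f' : M → ℝ} (h : f =ᶠ[𝓝 x] f') (hX : X x = Y x) :
    dirDeriv I X f x = dirDeriv I Y f' x := by
  simp only [dirDeriv, mvfderiv]
  rw [h.mfderiv_eq, hX]
  simp only [ContinuousLinearMap.comp_apply]
  rfl

/-! ### Pushing vector fields forward along a map -/

section Pushforward

variable {E' : Type*} [NormedAddCommGroup E'] [NormedSpace ℝ E']
  {H' : Type*} [TopologicalSpace H'] {I' : ModelWithCorners ℝ E' H'}
  {M' : Type*} [TopologicalSpace M'] [ChartedSpace H' M'] [IsManifold I' ∞ M']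

lemma FieldSmoothAt.mfderiv_apply {f : M → M'} (hf : ContMDiffAt I I' ∞ f x)
    (hX : FieldSmoothAt I X x) :
    ContMDiffAt I I'.tangent ∞
      (fun y => (Bundle.TotalSpace.mk' E' (f y) (mfderiv I I' f y (X y)) : TangentBundle I' M')) x := by
  have := hf.mfderiv_const (m := ∞) (by rfl)
  exact ContMDiffAt.clm_apply_of_inCoordinates (b₁ := id) (b₂ := f)
    (ϕ := fun y => mfderiv I I' f y) (v := X) this hX hf

lemma FieldDiffAt.mfderiv_apply {f : M → M'} (hf : ContMDiff I I' ∞ f)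
    (hX : FieldDiffAt I X x) :
    MDifferentiableAt I I'.tangent
      (fun y => (Bundle.TotalSpace.mk' E' (f y) (mfderiv I I' f y (X y)) : TangentBundle I' M')) x := by
  have : ContMDiff I.tangent I'.tangent 1 (tangentMap I I' f) :=
    hf.contMDiff_tangentMap (by rw [one_add_one_eq_two]; exact two_le_infty)
  exact ((this _).mdifferentiableAt one_ne_zero).comp x hX

end Pushforward

lemma contMDiffAt_dirDeriv {f : M → ℝ} (hf : ContMDiffAt I 𝓘(ℝ, ℝ) ∞ f x)
    (hX : FieldSmoothAt I X x) : ContMDiffAt I 𝓘(ℝ, ℝ) ∞ (dirDeriv I X f) x := by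
  have h := hX.mfderiv_apply hf
  exact (contMDiff_snd_tangentBundle_modelSpace ℝ 𝓘(ℝ, ℝ)).contMDiffAt.comp x h

end Fields

/-! ### Riemannian metrics and the musical isomorphism -/

section Metric

variable {E : Type*} [NormedAddCommGroup E] [NormedSpace ℝ E]
  {H : Type*} [TopologicalSpace H] {I : ModelWithCorners ℝ E H}
  {M : Type*} [TopologicalSpace M] [ChartedSpace H M] [IsManifold I ∞ M]

/-- The family `g` of bilinear forms is a smooth Riemannian metric. -/
structure IsSmoothMetric (g : Π x : M, TangentSpace I x →L[ℝ] TangentSpace I x →L[ℝ] ℝ) :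
    Prop where
  symm : ∀ x u v, g x u v = g x v u
  pos : ∀ x u, u ≠ 0 → 0 < g x u u
  -- Kept apart from `smooth`: Koszul's formula is needed at neighbouring points, where the fields
  -- are only known to be differentiable.
  diff : ∀ x X Y, FieldDiffAt I X x → FieldDiffAt I Y x →
    MDifferentiableAt I 𝓘(ℝ, ℝ) (fun y => g y (X y) (Y y)) x
  smooth : ∀ x X Y, FieldSmoothAt I X x → FieldSmoothAt I Y x →
    ContMDiffAt I 𝓘(ℝ, ℝ) ∞ (fun y => g y (X y) (Y y)) x

lemma contMDiffAt_det {ι : Type*} [Fintype ι] [DecidableEq ι] {A : M → Matrix ι ι ℝ} {x : M}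
    (h : ∀ i j, ContMDiffAt I 𝓘(ℝ, ℝ) ∞ (fun y => A y i j) x) :
    ContMDiffAt I 𝓘(ℝ, ℝ) ∞ (fun y => (A y).det) x := by
  simp only [Matrix.det_apply']
  refine contMDiffAt_finsetSum fun σ _ => ?_
  exact contMDiffAt_const.mul (contMDiffAt_finsetProd fun i _ => h _ _)

lemma contMDiffAt_matrix_inv {ι : Type*} [Fintype ι] [DecidableEq ι] {A : M → Matrix ι ι ℝ}
    {x : M} (h : ∀ i j, ContMDiffAt I 𝓘(ℝ, ℝ) ∞ (fun y => A y i j) x) (hx : (A x).det ≠ 0)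
    (i j : ι) : ContMDiffAt I 𝓘(ℝ, ℝ) ∞ (fun y => (A y)⁻¹ i j) x := by
  simp only [Matrix.inv_def, Matrix.smul_apply, smul_eq_mul, Ring.inverse_eq_inv',
    Matrix.adjugate_apply]
  refine ((contMDiffAt_det h).inv₀ hx).mul (contMDiffAt_det fun k l => ?_)
  simp only [Matrix.updateRow_apply]
  split_ifs
  · exact contMDiffAt_const
  · exact h k l

namespace IsSmoothMetric

variable {g : Π x : M, TangentSpace I x →L[ℝ] TangentSpace I x →L[ℝ] ℝ} (hg : IsSmoothMetric g)
  {X Y Z W : Π x : M, TangentSpace I x} {x : M}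
include hg

lemma ext_inner {u v : TangentSpace I x} (h : ∀ w, g x u w = g x v w) : u = v := by
  by_contra hne
  have h1 := hg.pos x (u - v) (sub_ne_zero.2 hne)
  have h2 : g x (u - v) (u - v) = 0 := by
    have h3 := h (u - v)
    simp only [map_sub, sub_apply] at h3 ⊢
    linarith
  linarith

/-- A null vector of the Gram matrix gives a combination of the `e i` orthogonal to every `e i`,
hence to itself. -/
lemma det_gram_ne_zero {ι : Type*} [Fintype ι] [DecidableEq ι] {e : ι → TangentSpace I x}
    (he : LinearIndependent ℝ e) : (Matrix.of fun i j => g x (e i) (e j)).det ≠ 0 := by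
  intro h0
  obtain ⟨v, hv, hv0⟩ := Matrix.exists_mulVec_eq_zero_iff.2 h0
  have h1 : ∑ j, v j • e j ≠ 0 := fun h => hv (funext (Fintype.linearIndependent_iff.1 he v h))
  have h2 := hg.pos x _ h1
  have h3 : ∀ i, g x (e i) (∑ j, v j • e j) = 0 := by
    intro i
    have := congrFun hv0 i
    simp only [Matrix.mulVec, dotProduct, Matrix.of_apply, Pi.zero_apply] at this
    rw [map_sum, ← this]
    exact Finset.sum_congr rfl fun j _ => by rw [map_smul, smul_eq_mul, mul_comm]
  have h4 : ∀ s, (∀ i, g x (e i) s = 0) → g x s (∑ j, v j • e j) = 0 := by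
    intro s hs
    rw [map_sum]
    refine Finset.sum_eq_zero fun i _ => ?_
    rw [map_smul, hg.symm, hs, smul_zero]
  exact h2.ne' (h4 _ h3)

/-- Near each point there are smooth local frames `e`, `e'` that are dual to each other with respect
to the metric. -/
lemma exists_dual_frame [FiniteDimensional ℝ E] (x : M) :
    ∃ e e' : Fin (Module.finrank ℝ E) → Π y : M, TangentSpace I y,
      (∀ k, FieldSmoothAt I (e k) x) ∧ (∀ k, FieldSmoothAt I (e' k) x) ∧
      ∀ᶠ y in 𝓝 x, ∀ w : TangentSpace I y, w = ∑ k, g y w (e k y) • e' k y := by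
  have : IsManifold I 1 M := inferInstance
  let t := trivializationAt E (TangentSpace I : M → Type _) x
  have hx : x ∈ t.baseSet := FiberBundle.mem_baseSet_trivializationAt' x
  let b := Module.finBasis ℝ E
  let e := t.localFrame b
  have hfr := t.isLocalFrameOn_localFrame_baseSet I ∞ b
  have hes : ∀ k, FieldSmoothAt I (e k) x := fun k => hfr.contMDiffAt t.open_baseSet hx k
  let G : M → Matrix (Fin (Module.finrank ℝ E)) (Fin (Module.finrank ℝ E)) ℝ :=
    fun y => Matrix.of fun i j => g y (e i y) (e j y)
  have hG : ∀ y ∈ t.baseSet, (G y).det ≠ 0 := fun y hy =>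
    hg.det_gram_ne_zero (hfr.linearIndependent hy)
  have hGs : ∀ i j, ContMDiffAt I 𝓘(ℝ, ℝ) ∞ (fun y => G y i j) x :=
    fun i j => hg.smooth x _ _ (hes i) (hes j)
  -- The dual frame is obtained by raising the index with the inverse Gram matrix, which is smooth
  -- by Cramer's rule.
  refine ⟨e, fun k y => ∑ l, (G y)⁻¹ k l • e l y, hes, fun k => ?_, ?_⟩
  · exact ContMDiffAt.sum_section fun l _ =>
      ContMDiffAt.smul_section (contMDiffAt_matrix_inv hGs (hG x hx) k l) (hes l)
  · filter_upwards [t.open_baseSet.mem_nhds hx] with y hy w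
    let c : Fin (Module.finrank ℝ E) → ℝ := (hfr.toBasisAt hy).repr w
    have hc : w = ∑ l, c l • e l y := by
      conv_lhs => rw [← (hfr.toBasisAt hy).sum_repr w]
      simp only [hfr.toBasisAt_coe]
      rfl
    have h1 : ∀ k, g y w (e k y) = Matrix.vecMul c (G y) k := by
      intro k
      rw [hg.symm, hc, map_sum]
      simp only [Matrix.vecMul, dotProduct, map_smul, smul_eq_mul]
      exact Finset.sum_congr rfl fun l _ => by rw [hg.symm]; rfl
    have h2 : Matrix.vecMul (Matrix.vecMul c (G y)) (G y)⁻¹ = c := by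
      rw [Matrix.vecMul_vecMul, Matrix.mul_nonsing_inv _ (isUnit_iff_ne_zero.2 (hG y hy)),
        Matrix.vecMul_one]
    simp only [h1, Finset.smul_sum, smul_smul]
    rw [Finset.sum_comm]
    conv_lhs => rw [hc]
    refine Finset.sum_congr rfl fun l _ => ?_
    rw [← Finset.sum_smul]
    congr 1
    exact (congrFun h2 l).symm

/-- A vector field is smooth if its scalar products with smooth vector fields are. -/
lemma fieldSmoothAt_of_inner [FiniteDimensional ℝ E]
    (h : ∀ Z, FieldSmoothAt I Z x → ContMDiffAt I 𝓘(ℝ, ℝ) ∞ (fun y => g y (W y) (Z y)) x) :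
    FieldSmoothAt I W x := by
  obtain ⟨e, e', he, he', hw⟩ := hg.exists_dual_frame x
  have : FieldSmoothAt I (fun y => ∑ k, g y (W y) (e k y) • e' k y) x :=
    ContMDiffAt.sum_section fun k _ => ContMDiffAt.smul_section (h _ (he k)) (he' k)
  exact this.congr (hw.mono fun y hy => (hy (W y)).symm)

/-- A fibrewise linear operator that maps smooth vector fields to smooth vector fields maps
differentiable vector fields to differentiable vector fields. -/
lemma fieldDiffAt_of_linear [FiniteDimensional ℝ E]
    {B : Π y : M, TangentSpace I y →L[ℝ] TangentSpace I y}
    (hB : ∀ Z, FieldSmoothAt I Z x → FieldSmoothAt I (fun y => B y (Z y)) x)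
    (hX : FieldDiffAt I X x) : FieldDiffAt I (fun y => B y (X y)) x := by
  obtain ⟨e, e', he, he', hw⟩ := hg.exists_dual_frame x
  have : FieldDiffAt I (fun y => ∑ k, g y (X y) (e k y) • B y (e' k y)) x :=
    MDifferentiableAt.sum_section fun k _ => MDifferentiableAt.smul_section
      (hg.diff x _ _ hX (he k).fieldDiffAt) (hB _ (he' k)).fieldDiffAt
  refine this.congr (hw.mono fun y hy => ?_)
  conv_rhs => rw [hy (X y)]
  simp [map_sum]

end IsSmoothMetric

end Metric

/-! ### The Levi-Civita connection -/

section LeviCivita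

variable {E : Type*} [NormedAddCommGroup E] [NormedSpace ℝ E] [FiniteDimensional ℝ E]
  {H : Type*} [TopologicalSpace H] {I : ModelWithCorners ℝ E H}
  {M : Type*} [TopologicalSpace M] [ChartedSpace H M] [IsManifold I ∞ M]

/-- The Levi-Civita covariant derivative of a metric given by continuous bilinear forms. -/
abbrev cov (g : Π x : M, TangentSpace I x →L[ℝ] TangentSpace I x →L[ℝ] ℝ)
    (X Y : Π x : M, TangentSpace I x) : Π x : M, TangentSpace I x :=
  leviCivita I (fun x u v => g x u v) X Y

open Classical in
/-- The covariant derivative `v ↦ ∇_v Y` of a vector field, as an endomorphism of the tangent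
space. -/
def nabla (g : Π x : M, TangentSpace I x →L[ℝ] TangentSpace I x →L[ℝ] ℝ)
    (Y : Π x : M, TangentSpace I x) (x : M) : TangentSpace I x →L[ℝ] TangentSpace I x :=
  have : IsManifold I 1 M := inferInstance
  -- By `tensorialAt_cov` the default 0 is never taken for a field `Y` that is differentiable at
  -- `x`.
  if h : TensorialAt I E (fun X => cov g X Y x) x then TensorialAt.mkHom _ x h else 0

namespace IsSmoothMetric

variable {g : Π x : M, TangentSpace I x →L[ℝ] TangentSpace I x →L[ℝ] ℝ} (hg : IsSmoothMetric g)
  {X Y Z W : Π x : M, TangentSpace I x} {x : M}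
include hg

lemma koszul_cov (hX : FieldDiffAt I X x) (hY : FieldDiffAt I Y x) (hZ : FieldDiffAt I Z x) :
    2 * g x (cov g X Y x) (Z x) = koszul I (fun x u v => g x u v) X Y Z x :=
  koszul_leviCivita I g hg.symm hg.pos hg.diff X Y x hX hY Z hZ

lemma inner_comm_fun (X Y : Π x : M, TangentSpace I x) :
    (fun y => g y (X y) (Y y)) = fun y => g y (Y y) (X y) := funext fun _ => hg.symm _ _ _

lemma ext_extend {u v : TangentSpace I x}
    (h : ∀ Z, FieldSmoothAt I Z x → g x u (Z x) = g x v (Z x)) : u = v :=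
  hg.ext_inner fun w => by
    have := h _ (fieldSmoothAt_extend w)
    rwa [FiberBundle.extend_apply_self] at this

/-- The Levi-Civita connection is torsion-free. -/
lemma cov_sub_cov (hX : FieldDiffAt I X x) (hY : FieldDiffAt I Y x) :
    cov g X Y x - cov g Y X x = VectorField.mlieBracket I X Y x := by
  refine hg.ext_extend fun Z hZ => ?_
  have h1 := hg.koszul_cov hX hY hZ.fieldDiffAt
  have h2 := hg.koszul_cov hY hX hZ.fieldDiffAt
  simp only [koszul] at h1 h2
  rw [VectorField.mlieBracket_swap_apply (V := Y) (W := X), hg.inner_comm_fun X Z,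
    hg.inner_comm_fun Y X, hg.inner_comm_fun Z Y] at h2
  simp only [map_sub, map_neg, neg_apply, sub_apply] at *
  linarith

/-- The Levi-Civita connection is metric. -/
lemma dirDeriv_inner (hX : FieldDiffAt I X x) (hY : FieldDiffAt I Y x) (hZ : FieldDiffAt I Z x) :
    dirDeriv I X (fun y => g y (Y y) (Z y)) x
      = g x (cov g X Y x) (Z x) + g x (Y x) (cov g X Z x) := by
  have h1 := hg.koszul_cov hX hY hZ
  have h2 := hg.koszul_cov hX hZ hY
  simp only [koszul] at h1 h2
  rw [VectorField.mlieBracket_swap_apply (V := Z) (W := Y), hg.inner_comm_fun X Z,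
    hg.inner_comm_fun Y X, hg.inner_comm_fun Z Y] at h2
  rw [hg.symm x (Y x)]
  simp only [map_neg, neg_apply] at *
  linarith

/-- In Koszul's formula the terms with derivatives of `f` cancel: those from Y g(Z, fX) and Z g(fX,
Y) against those from [fX, Y] and [fX, Z]. -/
lemma tensorialAt_cov (hY : FieldDiffAt I Y x) : TensorialAt I E (fun X => cov g X Y x) x := by
  have : IsManifold I 2 M := inferInstance
  have : IsManifold I 1 M := inferInstance
  have : CompleteSpace E := FiniteDimensional.complete ℝ E
  constructor
  · intro f X hf hX
    refine hg.ext_extend fun Z hZ => ?_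
    have hZ := hZ.fieldDiffAt
    have h0 := hg.koszul_cov hX hY hZ
    have h1 := hg.koszul_cov (FieldDiffAt.smul hf hX) hY hZ
    have e1 : (fun y => g y (Z y) (f y • X y)) = f * (fun y => g y (Z y) (X y)) := by
      ext y; simp
    have e2 : (fun y => g y (f y • X y) (Y y)) = f * (fun y => g y (X y) (Y y)) := by
      ext y; simp
    have e3 : (fun y => f y • X y) = f • X := rfl
    simp only [koszul, dirDeriv] at h0 h1
    rw [e1, e2, mvfderiv_mul hf (hg.diff x Z X hZ hX), mvfderiv_mul hf (hg.diff x X Y hX hY), e3,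
      VectorField.mlieBracket_smul_left hf hX, VectorField.mlieBracket_smul_left hf hX] at h1
    simp only [map_smul, smul_apply, add_apply, map_add, smul_eq_mul, map_neg,
      neg_apply, neg_smul] at h1 ⊢
    rw [hg.symm x (Z x) (X x)] at h1
    linear_combination (1 / 2) * h1 - (1 / 2) * f x * h0
  · intro X X' hX hX'
    refine hg.ext_extend fun Z hZ => ?_
    have hZ := hZ.fieldDiffAt
    have h0 := hg.koszul_cov hX hY hZ
    have h0' := hg.koszul_cov hX' hY hZ
    have h1 := hg.koszul_cov (FieldDiffAt.add hX hX') hY hZ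
    have e1 : (fun y => g y (Z y) (X y + X' y))
        = (fun y => g y (Z y) (X y)) + (fun y => g y (Z y) (X' y)) := by
      ext y; simp
    have e2 : (fun y => g y (X y + X' y) (Y y))
        = (fun y => g y (X y) (Y y)) + (fun y => g y (X' y) (Y y)) := by
      ext y; simp
    have e3 : (fun y => X y + X' y) = X + X' := rfl
    simp only [koszul, dirDeriv] at h0 h0' h1
    rw [e1, e2, mvfderiv_add (hg.diff x Z X hZ hX) (hg.diff x Z X' hZ hX'),
      mvfderiv_add (hg.diff x X Y hX hY) (hg.diff x X' Y hX' hY), e3,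
      VectorField.mlieBracket_add_left hX hX', VectorField.mlieBracket_add_left hX hX'] at h1
    simp only [add_apply, map_add] at h1 ⊢
    linear_combination (1 / 2) * h1 - (1 / 2) * h0 - (1 / 2) * h0'

lemma nabla_apply (hX : FieldDiffAt I X x) (hY : FieldDiffAt I Y x) :
    nabla g Y x (X x) = cov g X Y x := by
  have : IsManifold I 1 M := inferInstance
  rw [nabla, dif_pos (hg.tensorialAt_cov hY)]
  exact TensorialAt.mkHom_apply (hg.tensorialAt_cov hY) hX

lemma nabla_apply_extend (hY : FieldDiffAt I Y x) (v : TangentSpace I x) :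
    nabla g Y x v = cov g (FiberBundle.extend E v) Y x := by
  have := hg.nabla_apply (fieldSmoothAt_extend v).fieldDiffAt hY
  rwa [FiberBundle.extend_apply_self] at this

lemma mvfderiv_inner (hY : FieldDiffAt I Y x) (hZ : FieldDiffAt I Z x) (v : TangentSpace I x) :
    mvfderiv I (fun y => g y (Y y) (Z y)) x v
      = g x (nabla g Y x v) (Z x) + g x (Y x) (nabla g Z x v) := by
  have h := hg.dirDeriv_inner (fieldSmoothAt_extend v).fieldDiffAt hY hZ
  rw [hg.nabla_apply_extend hY, hg.nabla_apply_extend hZ, ← h, dirDeriv,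
    FiberBundle.extend_apply_self]

/-- Metric compatibility expresses ∇Y through derivatives of the functions g(Y, W). Pairing with
test fields W thus reduces this locality, as well as the negation, sum and product rules below, to
the same facts for functions. -/
lemma nabla_congr (hY : FieldDiffAt I Y x) (h : ∀ᶠ y in 𝓝 x, Y y = Z y) (v : TangentSpace I x) :
    nabla g Y x v = nabla g Z x v := by
  refine hg.ext_extend fun W hW => ?_
  have h1 := hg.mvfderiv_inner hY hW.fieldDiffAt v
  have h2 := hg.mvfderiv_inner (hY.congr h) hW.fieldDiffAt v
  have e : (fun y => g y (Y y) (W y)) =ᶠ[𝓝 x] fun y => g y (Z y) (W y) :=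
    h.mono fun y hy => by simp only [hy]
  have e' : mvfderiv I (fun y => g y (Y y) (W y)) x v = mvfderiv I (fun y => g y (Z y) (W y)) x v := by
    have := dirDeriv_congr (I := I) (X := FiberBundle.extend E v) e rfl
    rwa [dirDeriv, dirDeriv, FiberBundle.extend_apply_self] at this
  rw [e', h2, h.self_of_nhds] at h1
  linarith

lemma nabla_neg (hY : FieldDiffAt I Y x) (v : TangentSpace I x) :
    nabla g (fun y => - Y y) x v = - nabla g Y x v := by
  refine hg.ext_extend fun W hW => ?_
  have h1 := hg.mvfderiv_inner hY hW.fieldDiffAt v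
  have h2 := hg.mvfderiv_inner hY.neg hW.fieldDiffAt v
  have e : (fun y => g y (- Y y) (W y)) = - fun y => g y (Y y) (W y) := by ext y; simp
  rw [e, mvfderiv_neg] at h2
  simp only [map_neg, neg_apply] at h2 ⊢
  linarith

lemma nabla_add (hY : FieldDiffAt I Y x) (hZ : FieldDiffAt I Z x) (v : TangentSpace I x) :
    nabla g (fun y => Y y + Z y) x v = nabla g Y x v + nabla g Z x v := by
  refine hg.ext_extend fun W hW => ?_
  have h1 := hg.mvfderiv_inner hY hW.fieldDiffAt v
  have h1' := hg.mvfderiv_inner hZ hW.fieldDiffAt v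
  have h2 := hg.mvfderiv_inner (hY.add hZ) hW.fieldDiffAt v
  have e : (fun y => g y (Y y + Z y) (W y))
      = (fun y => g y (Y y) (W y)) + fun y => g y (Z y) (W y) := by ext y; simp
  rw [e, mvfderiv_add (hg.diff x Y W hY hW.fieldDiffAt) (hg.diff x Z W hZ hW.fieldDiffAt)] at h2
  simp only [map_add, add_apply] at h2 ⊢
  linarith

lemma nabla_smul {f : M → ℝ} (hf : MDifferentiableAt I 𝓘(ℝ, ℝ) f x) (hY : FieldDiffAt I Y x)
    (v : TangentSpace I x) :
    nabla g (fun y => f y • Y y) x v = f x • nabla g Y x v + mvfderiv I f x v • Y x := by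
  refine hg.ext_extend fun W hW => ?_
  have h1 := hg.mvfderiv_inner hY hW.fieldDiffAt v
  have h2 := hg.mvfderiv_inner (FieldDiffAt.smul hf hY) hW.fieldDiffAt v
  have e : (fun y => g y (f y • Y y) (W y)) = f * (fun y => g y (Y y) (W y)) := by ext y; simp
  rw [e, mvfderiv_mul hf (hg.diff x Y W hY hW.fieldDiffAt)] at h2
  simp only [map_smul, smul_apply, add_apply, map_add, smul_eq_mul] at h2 ⊢
  linear_combination f x * h1 - h2

/-- The covariant derivative of a smooth vector field along a smooth vector field is smooth. -/
lemma fieldSmoothAt_cov (hX : FieldSmoothAt I X x) (hY : FieldSmoothAt I Y x) :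
    FieldSmoothAt I (cov g X Y) x := by
  have : CompleteSpace E := FiniteDimensional.complete ℝ E
  refine hg.fieldSmoothAt_of_inner fun Z hZ => ?_
  have h : ContMDiffAt I 𝓘(ℝ, ℝ) ∞
      (fun y => (1 / 2 : ℝ) * koszul I (fun x u v => g x u v) X Y Z y) x := by
    refine contMDiffAt_const.mul ?_
    unfold koszul
    exact (((((contMDiffAt_dirDeriv (hg.smooth _ _ _ hY hZ) hX).add
      (contMDiffAt_dirDeriv (hg.smooth _ _ _ hZ hX) hY)).sub
      (contMDiffAt_dirDeriv (hg.smooth _ _ _ hX hY) hZ)).add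
      (hg.smooth _ _ _ (hX.mlieBracket hY) hZ)).sub
      (hg.smooth _ _ _ (hX.mlieBracket hZ) hY)).sub (hg.smooth _ _ _ (hY.mlieBracket hZ) hX)
  refine h.congr_of_eventuallyEq ?_
  filter_upwards [hX.eventually_fieldDiffAt, hY.eventually_fieldDiffAt,
    hZ.eventually_fieldDiffAt] with y h1 h2 h3
  rw [← hg.koszul_cov h1 h2 h3]
  ring

lemma fieldSmoothAt_nabla (hX : FieldSmoothAt I X x) (hY : FieldSmoothAt I Y x) :
    FieldSmoothAt I (fun y => nabla g Y y (X y)) x := by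
  refine (hg.fieldSmoothAt_cov hX hY).congr ?_
  filter_upwards [hX.eventually_fieldDiffAt, hY.eventually_fieldDiffAt] with y h1 h2
  exact (hg.nabla_apply h1 h2).symm

end IsSmoothMetric

end LeviCivita

/-! ### Killing vector fields -/

section Killing

variable {E : Type*} [NormedAddCommGroup E] [NormedSpace ℝ E] [FiniteDimensional ℝ E]
  {H : Type*} [TopologicalSpace H] {I : ModelWithCorners ℝ E H}
  {M : Type*} [TopologicalSpace M] [ChartedSpace H M] [IsManifold I ∞ M]

/-- The covariant derivative `(∇_v B) w` of a field `B` of endomorphisms. -/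
def nablaEnd (g : Π x : M, TangentSpace I x →L[ℝ] TangentSpace I x →L[ℝ] ℝ)
    (B : Π x : M, TangentSpace I x →L[ℝ] TangentSpace I x) (x : M) (v w : TangentSpace I x) :
    TangentSpace I x :=
  nabla g (fun y => B y (FiberBundle.extend E w y)) x v
    - B x (nabla g (FiberBundle.extend E w) x v)

namespace IsSmoothMetric

variable {g : Π x : M, TangentSpace I x →L[ℝ] TangentSpace I x →L[ℝ] ℝ} (hg : IsSmoothMetric g)
  {X Y Z W : Π x : M, TangentSpace I x} {x : M}
include hg

section Endomorphisms

variable {B : Π x : M, TangentSpace I x →L[ℝ] TangentSpace I x}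

/-- Leibniz rule for endomorphism fields. -/
lemma nabla_endo (hB : ∀ Z, FieldSmoothAt I Z x → FieldSmoothAt I (fun y => B y (Z y)) x)
    (hY : FieldDiffAt I Y x) (v : TangentSpace I x) :
    nabla g (fun y => B y (Y y)) x v = nablaEnd g B x v (Y x) + B x (nabla g Y x v) := by
  have : IsManifold I 1 M := inferInstance
  have hB' : ∀ {Z}, FieldDiffAt I Z x → FieldDiffAt I (fun y => B y (Z y)) x :=
    fun h => hg.fieldDiffAt_of_linear hB h
  -- The two terms (v f) · B Z cancel in the difference, so it depends on `Y x` only and `Y` may be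
  -- replaced by the extension used in `nablaEnd`.
  have T : TensorialAt I E (fun Y : Π y : M, TangentSpace I y =>
      nabla g (fun y => B y (Y y)) x v - B x (nabla g Y x v)) x := by
    constructor
    · intro f Z hf hZ
      have e : (fun y => B y ((f • Z) y)) = fun y => f y • B y (Z y) := by
        ext y; simp
      have e' : f • Z = fun y => f y • Z y := rfl
      simp only [e]
      rw [e', hg.nabla_smul hf (hB' hZ), hg.nabla_smul hf hZ]
      simp only [map_add, map_smul, smul_sub]
      abel
    · intro Z Z' hZ hZ'
      have e : (fun y => B y ((Z + Z') y)) = fun y => B y (Z y) + B y (Z' y) := by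
        ext y; simp
      have e' : Z + Z' = fun y => Z y + Z' y := rfl
      simp only [e]
      rw [e', hg.nabla_add (hB' hZ) (hB' hZ'), hg.nabla_add hZ hZ', map_add]
      abel
  have := T.pointwise hY (fieldSmoothAt_extend (Y x)).fieldDiffAt (by simp)
  rw [nablaEnd, ← this, sub_add_cancel]

end Endomorphisms

/-- The curvature term `R(W, X) Y` depends only on the value of `X` at the point. -/
lemma curvature_congr {X' : Π x : M, TangentSpace I x} (hW : FieldSmoothAt I W x)
    (hX : FieldSmoothAt I X x) (hX' : FieldSmoothAt I X' x) (hY : FieldSmoothAt I Y x)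
    (h : X x = X' x) :
    curvature I (fun x u v => g x u v) W X Y x = curvature I (fun x u v => g x u v) W X' Y x := by
  have : CompleteSpace E := FiniteDimensional.complete ℝ E
  -- The term ∇_{∇_W X} Y occurs in both ∇_W ∇_X Y and ∇_{[W, X]} Y and cancels. On the right-hand
  -- side `X` enters through its value at `x` alone.
  have key : ∀ X, FieldSmoothAt I X x → curvature I (fun x u v => g x u v) W X Y x
      = nablaEnd g (nabla g Y) x (W x) (X x) - nabla g (cov g W Y) x (X x)
        + nabla g Y x (nabla g W x (X x)) := by
    intro X hX
    have h1 : cov g W (cov g X Y) x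
        = nablaEnd g (nabla g Y) x (W x) (X x) + nabla g Y x (nabla g X x (W x)) := by
      rw [← hg.nabla_endo (fun Z hZ => hg.fieldSmoothAt_nabla hZ hY) hX.fieldDiffAt,
        ← hg.nabla_apply hW.fieldDiffAt (hg.fieldSmoothAt_cov hX hY).fieldDiffAt]
      refine hg.nabla_congr (hg.fieldSmoothAt_cov hX hY).fieldDiffAt ?_ _
      filter_upwards [hX.eventually_fieldDiffAt, hY.eventually_fieldDiffAt] with y h1 h2
      exact (hg.nabla_apply h1 h2).symm
    have h2 : cov g (VectorField.mlieBracket I W X) Y x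
        = nabla g Y x (nabla g X x (W x)) - nabla g Y x (nabla g W x (X x)) := by
      rw [← map_sub, ← hg.nabla_apply (hW.mlieBracket hX).fieldDiffAt hY.fieldDiffAt,
        ← hg.cov_sub_cov hW.fieldDiffAt hX.fieldDiffAt,
        hg.nabla_apply hW.fieldDiffAt hX.fieldDiffAt, hg.nabla_apply hX.fieldDiffAt hW.fieldDiffAt]
    have h3 := hg.nabla_apply hX.fieldDiffAt (hg.fieldSmoothAt_cov hW hY).fieldDiffAt
    rw [curvature]
    change cov g W (cov g X Y) x - cov g X (cov g W Y) x
      - cov g (VectorField.mlieBracket I W X) Y x = _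
    rw [h1, h2, h3]
    abel
  rw [key X hX, key X' hX', h]

variable {ξ : Π x : M, TangentSpace I x} (hξ : ∀ x, FieldSmoothAt I ξ x)
  (hA : ∀ x v w, g x (nabla g ξ x v) w = - g x v (nabla g ξ x w))
include hξ hA

/-- The metric is invariant under a Killing vector field. -/
lemma dirDeriv_killing (hX : FieldDiffAt I X x) (hY : FieldDiffAt I Y x) :
    dirDeriv I ξ (fun y => g y (X y) (Y y)) x
      = g x (VectorField.mlieBracket I ξ X x) (Y x)
        + g x (X x) (VectorField.mlieBracket I ξ Y x) := by
  have h := (hξ x).fieldDiffAt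
  rw [hg.dirDeriv_inner h hX hY, ← hg.cov_sub_cov h hX, ← hg.cov_sub_cov h hY,
    ← hg.nabla_apply hX h, ← hg.nabla_apply hY h]
  have := hA x (X x) (Y x)
  simp only [map_sub, sub_apply]
  linarith

/-- A Killing vector field preserves the Levi-Civita connection. -/
lemma mlieBracket_cov [I.Boundaryless] (hW : FieldSmoothAt I W x) (hY : FieldSmoothAt I Y x) :
    VectorField.mlieBracket I ξ (cov g W Y) x
      = cov g (VectorField.mlieBracket I ξ W) Y x + cov g W (VectorField.mlieBracket I ξ Y) x := by
  have : CompleteSpace E := FiniteDimensional.complete ℝ E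
  have hξx := hξ x
  have K : ∀ {X Y : Π x : M, TangentSpace I x} {y : M}, FieldDiffAt I X y → FieldDiffAt I Y y →
      dirDeriv I ξ (fun y => g y (X y) (Y y)) y
        = g y (VectorField.mlieBracket I ξ X y) (Y y)
          + g y (X y) (VectorField.mlieBracket I ξ Y y) :=
    fun h1 h2 => hg.dirDeriv_killing hξ hA h1 h2
  -- the Lie derivative commutes with the derivatives of scalar products
  have D : ∀ {X Y Z : Π x : M, TangentSpace I x}, FieldSmoothAt I X x → FieldSmoothAt I Y x →
      FieldSmoothAt I Z x →
      dirDeriv I ξ (dirDeriv I X (fun y => g y (Y y) (Z y))) x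
        = dirDeriv I (VectorField.mlieBracket I ξ X) (fun y => g y (Y y) (Z y)) x
        + dirDeriv I X (fun y => g y (VectorField.mlieBracket I ξ Y y) (Z y)) x
        + dirDeriv I X (fun y => g y (Y y) (VectorField.mlieBracket I ξ Z y)) x := by
    intro X Y Z hX hY hZ
    have hs := hg.smooth x Y Z hY hZ
    rw [dirDeriv_mlieBracket (ContMDiffAt.of_le hs two_le_infty) hξx.fieldDiffAt hX.fieldDiffAt]
    have e : dirDeriv I X (dirDeriv I ξ (fun y => g y (Y y) (Z y))) x
        = dirDeriv I X ((fun y => g y (VectorField.mlieBracket I ξ Y y) (Z y))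
          + fun y => g y (Y y) (VectorField.mlieBracket I ξ Z y)) x := by
      refine dirDeriv_congr ?_ rfl
      filter_upwards [hY.eventually_fieldDiffAt, hZ.eventually_fieldDiffAt] with y h1 h2
      exact K h1 h2
    have e2 : ∀ {f f' : M → ℝ}, MDifferentiableAt I 𝓘(ℝ, ℝ) f x →
        MDifferentiableAt I 𝓘(ℝ, ℝ) f' x →
        dirDeriv I X (f + f') x = dirDeriv I X f x + dirDeriv I X f' x := by
      intro f f' hf hf'
      simp only [dirDeriv, mvfderiv_add hf hf', add_apply]
    rw [e, e2 (hg.diff _ _ _ (hξx.mlieBracket hY).fieldDiffAt hZ.fieldDiffAt)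
      (hg.diff _ _ _ hY.fieldDiffAt (hξx.mlieBracket hZ).fieldDiffAt)]
    ring
  -- The Lie derivative distributes over g([X, Y], Z): invariance of the metric combined with the
  -- Jacobi identity.
  have J : ∀ {X Y Z : Π x : M, TangentSpace I x}, FieldSmoothAt I X x → FieldSmoothAt I Y x →
      FieldSmoothAt I Z x →
      dirDeriv I ξ (fun y => g y (VectorField.mlieBracket I X Y y) (Z y)) x
        = g x (VectorField.mlieBracket I (VectorField.mlieBracket I ξ X) Y x) (Z x)
        + g x (VectorField.mlieBracket I X (VectorField.mlieBracket I ξ Y) x) (Z x)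
        + g x (VectorField.mlieBracket I X Y x) (VectorField.mlieBracket I ξ Z x) := by
    intro X Y Z hX hY hZ
    rw [K (hX.mlieBracket hY).fieldDiffAt hZ.fieldDiffAt, mlieBracket_jacobi hξx hX hY]
    simp only [map_add, add_apply]
  refine hg.ext_extend fun Z hZ => ?_
  have hWY := hg.fieldSmoothAt_cov hW hY
  have h1 := K hWY.fieldDiffAt hZ.fieldDiffAt
  have h2 := hg.koszul_cov hW.fieldDiffAt hY.fieldDiffAt (hξx.mlieBracket hZ).fieldDiffAt
  have h3 := hg.koszul_cov (hξx.mlieBracket hW).fieldDiffAt hY.fieldDiffAt hZ.fieldDiffAt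
  have h4 := hg.koszul_cov hW.fieldDiffAt (hξx.mlieBracket hY).fieldDiffAt hZ.fieldDiffAt
  -- Koszul's formula holds near `x`, so it can be differentiated along ξ; each of its six terms is
  -- then expanded with `D` or `J`.
  have h5 : 2 * dirDeriv I ξ (fun y => g y (cov g W Y y) (Z y)) x
      = dirDeriv I ξ (koszul I (fun x u v => g x u v) W Y Z) x := by
    have e : koszul I (fun x u v => g x u v) W Y Z
        =ᶠ[𝓝 x] (fun _ => (2 : ℝ)) * fun y => g y (cov g W Y y) (Z y) := by
      filter_upwards [hW.eventually_fieldDiffAt, hY.eventually_fieldDiffAt,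
        hZ.eventually_fieldDiffAt] with y a b c
      exact (hg.koszul_cov a b c).symm
    rw [dirDeriv_congr e rfl]
    simp only [dirDeriv]
    rw [mvfderiv_mul mdifferentiableAt_const (hg.diff _ _ _ hWY.fieldDiffAt hZ.fieldDiffAt),
      mvfderiv_const]
    simp
  have h6 : dirDeriv I ξ (koszul I (fun x u v => g x u v) W Y Z) x
      = dirDeriv I ξ (dirDeriv I W (fun y => g y (Y y) (Z y))) x
        + dirDeriv I ξ (dirDeriv I Y (fun y => g y (Z y) (W y))) x
        - dirDeriv I ξ (dirDeriv I Z (fun y => g y (W y) (Y y))) x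
        + dirDeriv I ξ (fun y => g y (VectorField.mlieBracket I W Y y) (Z y)) x
        - dirDeriv I ξ (fun y => g y (VectorField.mlieBracket I W Z y) (Y y)) x
        - dirDeriv I ξ (fun y => g y (VectorField.mlieBracket I Y Z y) (W y)) x := by
    have a1 := (contMDiffAt_dirDeriv (hg.smooth _ _ _ hY hZ) hW).mdifferentiableAt (by simp)
    have a2 := (contMDiffAt_dirDeriv (hg.smooth _ _ _ hZ hW) hY).mdifferentiableAt (by simp)
    have a3 := (contMDiffAt_dirDeriv (hg.smooth _ _ _ hW hY) hZ).mdifferentiableAt (by simp)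
    have a4 := hg.diff _ _ _ (hW.mlieBracket hY).fieldDiffAt hZ.fieldDiffAt
    have a5 := hg.diff _ _ _ (hW.mlieBracket hZ).fieldDiffAt hY.fieldDiffAt
    have a6 := hg.diff _ _ _ (hY.mlieBracket hZ).fieldDiffAt hW.fieldDiffAt
    have e : koszul I (fun x u v => g x u v) W Y Z
        = dirDeriv I W (fun y => g y (Y y) (Z y)) + dirDeriv I Y (fun y => g y (Z y) (W y))
        - dirDeriv I Z (fun y => g y (W y) (Y y))
        + (fun y => g y (VectorField.mlieBracket I W Y y) (Z y))
        - (fun y => g y (VectorField.mlieBracket I W Z y) (Y y))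
        - (fun y => g y (VectorField.mlieBracket I Y Z y) (W y)) := rfl
    rw [e]
    simp only [dirDeriv] at *
    rw [mvfderiv_sub ((((a1.add a2).sub a3).add a4).sub a5) a6,
      mvfderiv_sub (((a1.add a2).sub a3).add a4) a5, mvfderiv_add ((a1.add a2).sub a3) a4,
      mvfderiv_sub (a1.add a2) a3, mvfderiv_add a1 a2]
    simp only [sub_apply, add_apply]
  rw [h6, D hW hY hZ, D hY hZ hW, D hZ hW hY, J hW hY hZ, J hW hZ hY, J hY hZ hW] at h5
  simp only [koszul] at h2 h3 h4
  simp only [map_add, add_apply]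
  -- By the Leibniz rule the differentiated formula is the sum of the three Koszul formulas in which
  -- one of `W`, `Y`, `Z` is replaced by its bracket with ξ.
  linear_combination (1 / 2) * h5 - h1 - (1 / 2) * h2 - (1 / 2) * h3 - (1 / 2) * h4

/-- For a Killing vector field `ξ`, one has `R(W, ξ) Y = (∇_W (∇ξ)) Y`. -/
lemma curvature_killing [I.Boundaryless] (hW : FieldSmoothAt I W x) (hY : FieldSmoothAt I Y x) :
    curvature I (fun x u v => g x u v) W ξ Y x = nablaEnd g (nabla g ξ) x (W x) (Y x) := by
  have : CompleteSpace E := FiniteDimensional.complete ℝ E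
  have hξx := hξ x
  have hWY := hg.fieldSmoothAt_cov hW hY
  have hAY : FieldSmoothAt I (fun y => nabla g ξ y (Y y)) x := hg.fieldSmoothAt_nabla hY hξx
  have hξY := hξx.mlieBracket hY
  -- Torsion-freeness in the form ∇_ξ Y = AY + [ξ, Y], with A = ∇ξ, is used near `x` here and for
  -- ∇_W Y in `h2`.
  have h1 : cov g W (cov g ξ Y) x = nabla g (fun y => nabla g ξ y (Y y)) x (W x)
      + cov g W (VectorField.mlieBracket I ξ Y) x := by
    rw [← hg.nabla_apply hW.fieldDiffAt (hg.fieldSmoothAt_cov hξx hY).fieldDiffAt,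
      ← hg.nabla_apply hW.fieldDiffAt hξY.fieldDiffAt, ← hg.nabla_add hAY.fieldDiffAt hξY.fieldDiffAt]
    refine hg.nabla_congr (hg.fieldSmoothAt_cov hξx hY).fieldDiffAt ?_ _
    filter_upwards [hY.eventually_fieldDiffAt] with y hy
    rw [hg.nabla_apply hy (hξ y).fieldDiffAt, ← hg.cov_sub_cov (hξ y).fieldDiffAt hy]
    abel
  have h2 : cov g ξ (cov g W Y) x = nabla g ξ x (nabla g Y x (W x))
      + VectorField.mlieBracket I ξ (cov g W Y) x := by
    rw [← hg.cov_sub_cov hξx.fieldDiffAt hWY.fieldDiffAt,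
      ← hg.nabla_apply hWY.fieldDiffAt hξx.fieldDiffAt, hg.nabla_apply hW.fieldDiffAt hY.fieldDiffAt]
    abel
  have h3 : cov g (VectorField.mlieBracket I W ξ) Y x
      = - cov g (VectorField.mlieBracket I ξ W) Y x := by
    rw [← hg.nabla_apply (hW.mlieBracket hξx).fieldDiffAt hY.fieldDiffAt,
      ← hg.nabla_apply (hξx.mlieBracket hW).fieldDiffAt hY.fieldDiffAt,
      VectorField.mlieBracket_swap_apply, map_neg]
  rw [curvature]
  change cov g W (cov g ξ Y) x - cov g ξ (cov g W Y) x
      - cov g (VectorField.mlieBracket I W ξ) Y x = _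
  -- Invariance of the connection cancels every bracket with ξ, leaving ∇_W(AY) - A(∇_W Y).
  rw [h1, h2, h3, hg.mlieBracket_cov hξ hA hW hY,
    hg.nabla_endo (fun Z hZ => hg.fieldSmoothAt_nabla hZ hξx) hY.fieldDiffAt]
  abel

/-- The covariant derivative of a field of skew-symmetric endomorphisms is skew-symmetric. -/
lemma nablaEnd_skew (v y z : TangentSpace I x) :
    g x (nablaEnd g (nabla g ξ) x v y) z = - g x y (nablaEnd g (nabla g ξ) x v z) := by
  have hy := fieldSmoothAt_extend (I := I) y
  have hz := fieldSmoothAt_extend (I := I) z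
  have h1 := hg.mvfderiv_inner (hg.fieldSmoothAt_nabla hy (hξ x)).fieldDiffAt hz.fieldDiffAt v
  have h2 := hg.mvfderiv_inner hy.fieldDiffAt (hg.fieldSmoothAt_nabla hz (hξ x)).fieldDiffAt v
  have e : (fun w => g w (nabla g ξ w (FiberBundle.extend E y w)) (FiberBundle.extend E z w))
      = - fun w => g w (FiberBundle.extend E y w) (nabla g ξ w (FiberBundle.extend E z w)) := by
    ext w; exact hA _ _ _
  rw [e, mvfderiv_neg, neg_apply, h2] at h1
  simp only [nablaEnd, map_sub, sub_apply, FiberBundle.extend_apply_self] at h1 ⊢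
  have h3 := hA x (nabla g (FiberBundle.extend E y) x v) z
  have h4 := hA x y (nabla g (FiberBundle.extend E z) x v)
  linarith

end IsSmoothMetric

end Killing

/-! ### Metric traces -/

section Trace

variable {V : Type*} [AddCommGroup V] [Module ℝ V] {b : LinearMap.BilinForm ℝ V}
  {W : Submodule ℝ V}

lemma exists_orthonormal [FiniteDimensional ℝ V] (hs : ∀ u v, b u v = b v u)
    (hp : ∀ u, u ≠ 0 → 0 < b u u) (W : Submodule ℝ V) :
    ∃ e : Fin (Module.finrank ℝ W) → V,
      (∀ i, e i ∈ W) ∧ ∀ i j, b (e i) (e j) = if i = j then 1 else 0 := by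
  have hsymm : LinearMap.IsSymm (b.restrict W) := ⟨fun u v => hs u v⟩
  obtain ⟨v, hv⟩ := LinearMap.BilinForm.exists_orthogonal_basis hsymm
  have hpos : ∀ i, 0 < b (v i) (v i) := fun i => hp _ (by simpa using v.ne_zero i)
  refine ⟨fun i => (Real.sqrt (b (v i) (v i)))⁻¹ • (v i : V),
    fun i => W.smul_mem _ (v i).2, fun i j => ?_⟩
  simp only [map_smul, LinearMap.smul_apply, smul_eq_mul]
  split_ifs with h
  · subst h
    have := Real.mul_self_sqrt (hpos i).le
    have h0 := (Real.sqrt_pos.2 (hpos i)).ne'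
    field_simp
    nlinarith
  · have h0 : b (v i) (v j) = 0 := hv h
    rw [h0]; simp

lemma eq_sum_orthonormal [FiniteDimensional ℝ V] {ι : Type*} [Fintype ι] [DecidableEq ι]
    {e : ι → V} (hW : ∀ i, e i ∈ W) (he : ∀ i j, b (e i) (e j) = if i = j then 1 else 0)
    (hc : Fintype.card ι = Module.finrank ℝ W) {v : V} (hv : v ∈ W) :
    v = ∑ i, b v (e i) • e i := by
  have key : ∀ (c : ι → ℝ) (j : ι), b (∑ i, c i • e i) (e j) = c j := by
    intro c j
    simp [LinearMap.sum_apply, he]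
  let e' : ι → W := fun i => ⟨e i, hW i⟩
  have hli : LinearIndependent ℝ e' := by
    rw [Fintype.linearIndependent_iff]
    intro c h i
    have : ∑ i, c i • e i = 0 := by simpa [e'] using congrArg Subtype.val h
    rw [← key c i, this]; simp
  have hspan := hli.span_eq_top_of_card_eq_finrank' hc
  have : (⟨v, hv⟩ : W) ∈ Submodule.span ℝ (Set.range e') := by rw [hspan]; trivial
  obtain ⟨c, h⟩ := (Submodule.mem_span_range_iff_exists_fun ℝ).1 this
  have hv' : v = ∑ i, c i • e i := by simpa [e'] using (congrArg Subtype.val h).symm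
  have hcv : ∀ i, b v (e i) = c i := fun i => by rw [hv', key]
  simp only [hcv]
  exact hv'

/-- The family `f` need not be assumed orthonormal. Mutual expansion with the orthonormal `e`
already makes the coefficient matrix satisfy the relations `h1`, which are all that invariance of
the trace requires. -/
lemma sum_orthonormal_eq {ι κ : Type*} [Fintype ι] [Fintype κ] [DecidableEq ι]
    (hs : ∀ u v, b u v = b v u) {e : ι → V} {f : κ → V}
    (he : ∀ i j, b (e i) (e j) = if i = j then 1 else 0)
    (hfe : ∀ j, f j = ∑ i, b (f j) (e i) • e i) (hef : ∀ i, e i = ∑ j, b (e i) (f j) • f j)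
    (B : LinearMap.BilinForm ℝ V) : ∑ j, B (f j) (f j) = ∑ i, B (e i) (e i) := by
  have h1 : ∀ i k, ∑ j, b (f j) (e i) * b (f j) (e k) = if i = k then 1 else 0 := by
    intro i k
    rw [← he i k]
    conv_rhs => rw [hef i]
    simp [LinearMap.sum_apply, hs (e i)]
  have h2 : ∀ j, B (f j) (f j) = ∑ i, ∑ k, (b (f j) (e i) * b (f j) (e k)) * B (e i) (e k) := by
    intro j
    conv_lhs => rw [hfe j]
    simp only [map_sum, LinearMap.sum_apply, map_smul, LinearMap.smul_apply, smul_eq_mul,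
      Finset.mul_sum]
    rw [Finset.sum_comm]
    exact Finset.sum_congr rfl fun i _ => Finset.sum_congr rfl fun k _ => by ring
  simp only [h2]
  rw [Finset.sum_comm]
  refine Finset.sum_congr rfl fun i _ => ?_
  rw [Finset.sum_comm]
  simp only [← Finset.sum_mul, h1]
  simp

/-- The metric trace is the trace over some orthonormal basis. -/
lemma exists_metricTrace_eq [FiniteDimensional ℝ V] (hs : ∀ u v, b u v = b v u)
    (hp : ∀ u, u ≠ 0 → 0 < b u u) (W : Submodule ℝ V) (B : V → V → ℝ) :
    ∃ e : Fin (Module.finrank ℝ W) → V, (∀ i, e i ∈ W) ∧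
      (∀ i j, b (e i) (e j) = if i = j then 1 else 0) ∧
      (∀ v ∈ W, v = ∑ i, b v (e i) • e i) ∧
      metricTrace (fun u v => b u v) W B = ∑ i, B (e i) (e i) := by
  have h := exists_orthonormal hs hp W
  refine ⟨h.choose, h.choose_spec.1, h.choose_spec.2, fun v hv =>
    eq_sum_orthonormal h.choose_spec.1 h.choose_spec.2 (by simp) hv, ?_⟩
  rw [metricTrace, dif_pos h]

end Trace

/-! ### Sasakian manifolds -/

section ExteriorDerivative

variable {E : Type*} [NormedAddCommGroup E] [NormedSpace ℝ E] [FiniteDimensional ℝ E]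
  {H : Type*} [TopologicalSpace H] {I : ModelWithCorners ℝ E H}
  {M : Type*} [TopologicalSpace M] [ChartedSpace H M] [IsManifold I ∞ M]
  {η : Π x : M, TangentSpace I x →L[ℝ] ℝ} {X X' Y Y' : Π x : M, TangentSpace I x} {x : M}

lemma extDeriv₁_swap : extDeriv₁ I η X Y x = - extDeriv₁ I η Y X x := by
  rw [extDeriv₁, extDeriv₁, VectorField.mlieBracket_swap_apply, map_neg]
  ring

/-- The derivative of the coefficient arising from Y η(fX) cancels the one arising from [fX, Y].
This serves to extend the contact condition from smooth to differentiable fields. -/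
lemma extDeriv₁_congr_left
    (hη : ∀ X, FieldDiffAt I X x → MDifferentiableAt I 𝓘(ℝ, ℝ) (fun y => η y (X y)) x)
    (hX : FieldDiffAt I X x) (hX' : FieldDiffAt I X' x) (h : X x = X' x) :
    extDeriv₁ I η X Y x = extDeriv₁ I η X' Y x := by
  have : IsManifold I 2 M := inferInstance
  have : IsManifold I 1 M := inferInstance
  have : CompleteSpace E := FiniteDimensional.complete ℝ E
  have T : TensorialAt I E (fun X : Π y : M, TangentSpace I y => extDeriv₁ I η X Y x) x := by
    constructor
    · intro f Z hf hZ
      have e : (fun y => η y ((f • Z) y)) = f * (fun y => η y (Z y)) := by ext y; simp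
      simp only [extDeriv₁, dirDeriv]
      rw [e, mvfderiv_mul hf (hη Z hZ), VectorField.mlieBracket_smul_left hf hZ]
      simp
      ring
    · intro Z Z' hZ hZ'
      have e : (fun y => η y ((Z + Z') y)) = (fun y => η y (Z y)) + (fun y => η y (Z' y)) := by
        ext y; simp
      simp only [extDeriv₁, dirDeriv]
      rw [e, mvfderiv_add (hη Z hZ) (hη Z' hZ'), VectorField.mlieBracket_add_left hZ hZ']
      simp
      ring
  exact T.pointwise hX hX' h

lemma extDeriv₁_congr
    (hη : ∀ X, FieldDiffAt I X x → MDifferentiableAt I 𝓘(ℝ, ℝ) (fun y => η y (X y)) x)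
    (hX : FieldDiffAt I X x) (hX' : FieldDiffAt I X' x) (h : X x = X' x)
    (hY : FieldDiffAt I Y x) (hY' : FieldDiffAt I Y' x) (h' : Y x = Y' x) :
    extDeriv₁ I η X Y x = extDeriv₁ I η X' Y' x := by
  rw [extDeriv₁_congr_left hη hX hX' h, extDeriv₁_swap, extDeriv₁_congr_left hη hY hY' h',
    ← extDeriv₁_swap]

end ExteriorDerivative

/-! ### Scalar products of vector fields along a map -/

section Along

variable {E : Type*} [NormedAddCommGroup E] [NormedSpace ℝ E]
  {H : Type*} [TopologicalSpace H] {I : ModelWithCorners ℝ E H}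
  {M : Type*} [TopologicalSpace M] [ChartedSpace H M] [IsManifold I ∞ M]
  {E' : Type*} [NormedAddCommGroup E'] [NormedSpace ℝ E']
  {H' : Type*} [TopologicalSpace H'] {I' : ModelWithCorners ℝ E' H'}
  {P : Type*} [TopologicalSpace P] [ChartedSpace H' P]
  (g : Bundle.ContMDiffRiemannianMetric I ∞ E (fun x : M => TangentSpace I x))
  {b : P → M} {v w : Π p, TangentSpace I (b p)} {p : P}

lemma contMDiffAt_inner_along
    (hv : ContMDiffAt I' I.tangent ∞
      (fun p => (Bundle.TotalSpace.mk' E (b p) (v p) : TangentBundle I M)) p)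
    (hw : ContMDiffAt I' I.tangent ∞
      (fun p => (Bundle.TotalSpace.mk' E (b p) (w p) : TangentBundle I M)) p) :
    ContMDiffAt I' 𝓘(ℝ, ℝ) ∞ (fun p => g.inner (b p) (v p) (w p)) p := by
  have hb : ContMDiffAt I' I ∞ b p := (Bundle.contMDiffAt_totalSpace.1 hv).1
  have : ContMDiffAt I' (I.prod 𝓘(ℝ, ℝ)) ∞ (fun m => Bundle.TotalSpace.mk' ℝ
      (E := Bundle.Trivial M ℝ) (b m) (g.inner (b m) (v m) (w m))) p := by
    apply ContMDiffAt.clm_bundle_apply₂ (F₁ := E) (F₂ := E)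
    · exact ContMDiffAt.comp p g.contMDiff.contMDiffAt hb
    · exact hv
    · exact hw
  exact (Bundle.contMDiffAt_totalSpace.1 this).2

lemma mdifferentiableAt_inner_along
    (hv : MDifferentiableAt I' I.tangent
      (fun p => (Bundle.TotalSpace.mk' E (b p) (v p) : TangentBundle I M)) p)
    (hw : MDifferentiableAt I' I.tangent
      (fun p => (Bundle.TotalSpace.mk' E (b p) (w p) : TangentBundle I M)) p) :
    MDifferentiableAt I' 𝓘(ℝ, ℝ) (fun p => g.inner (b p) (v p) (w p)) p := by
  have hb : MDifferentiableAt I' I b p := (mdifferentiableAt_totalSpace _ _ |>.1 hv).1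
  have : MDifferentiableAt I' (I.prod 𝓘(ℝ, ℝ)) (fun m => Bundle.TotalSpace.mk' ℝ
      (E := Bundle.Trivial M ℝ) (b m) (g.inner (b m) (v m) (w m))) p := by
    apply MDifferentiableAt.clm_bundle_apply₂ (F₁ := E) (F₂ := E)
    · exact MDifferentiableAt.comp p (g.contMDiff.mdifferentiable (by simp) _) hb
    · exact hv
    · exact hw
  exact (mdifferentiableAt_totalSpace _ _ |>.1 this).2

end Along

namespace SasakianStructure

variable {n : ℕ} {M : Type*} [TopologicalSpace M]
  [ChartedSpace (EuclideanSpace ℝ (Fin (2 * n + 1))) M] [IsManifold (𝓡 (2 * n + 1)) ∞ M]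
  (S : SasakianStructure n M) {X Y Z : Π x : M, TangentSpace (𝓡 (2 * n + 1)) x} {x : M}

lemma isSmoothMetric : IsSmoothMetric (I := 𝓡 (2 * n + 1)) S.g.inner where
  symm := S.g.symm
  pos := S.g.pos
  diff _ _ _ hX hY := mdifferentiableAt_inner_along S.g hX hY
  smooth _ _ _ hX hY := contMDiffAt_inner_along S.g hX hY

/-- Since φ²ξ = 0, the formula for φ² applied to φξ gives φξ = η(φξ) ξ. Applying φ once more forces
η(φξ) = 0 or φξ = 0. -/
lemma φ_ξ (x : M) : S.φ x (S.ξ x) = 0 := by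
  have h1 := S.φ_sq x (S.ξ x)
  rw [S.η_ξ, one_smul, neg_add_cancel] at h1
  have h2 := S.φ_sq x (S.φ x (S.ξ x))
  rw [h1, map_zero] at h2
  have h3 : S.φ x (S.ξ x) = S.η x (S.φ x (S.ξ x)) • S.ξ x := by
    rw [← sub_eq_zero, sub_eq_neg_add, ← neg_eq_zero.2 h2.symm]
    abel
  rw [h3, map_smul, smul_eq_zero] at h1
  rcases h1 with h | h
  · rw [h3, h, zero_smul]
  · exact h

/-- Compare φ²(φv) with φ(φ²v), using φξ = 0. -/
lemma η_φ (x : M) (v : TangentSpace (𝓡 (2 * n + 1)) x) : S.η x (S.φ x v) = 0 := by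
  have h1 := S.φ_sq x (S.φ x v)
  rw [S.φ_sq x v, map_add, map_neg, map_smul, S.φ_ξ, smul_zero, add_zero] at h1
  have h2 : S.η x (S.φ x v) • S.ξ x = 0 := by
    have := h1.symm
    rwa [add_eq_left] at this
  have := congrArg (S.η x) h2
  rwa [map_smul, S.η_ξ, smul_eq_mul, mul_one, map_zero] at this

lemma inner_ξ (x : M) (v : TangentSpace (𝓡 (2 * n + 1)) x) : S.g.inner x v (S.ξ x) = S.η x v := by
  have h := S.compatible x v (S.ξ x)
  rw [S.φ_ξ, map_zero, S.η_ξ] at h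
  linarith

lemma inner_φ_left (x : M) (u v : TangentSpace (𝓡 (2 * n + 1)) x) :
    S.g.inner x (S.φ x u) v = - S.g.inner x u (S.φ x v) := by
  have h := S.compatible x u (S.φ x v)
  rw [S.φ_sq, map_add, map_neg, map_smul, S.inner_ξ, S.η_φ, S.η_φ] at h
  simp only [smul_zero, mul_zero] at h
  linarith

lemma mdifferentiableAt_η (hX : FieldDiffAt (𝓡 (2 * n + 1)) X x) :
    MDifferentiableAt (𝓡 (2 * n + 1)) 𝓘(ℝ, ℝ) (fun y => S.η y (X y)) x := by
  have := S.isSmoothMetric.diff x X S.ξ hX (S.smooth_ξ x).fieldDiffAt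
  simpa only [S.inner_ξ] using this

/-- Both sides are tensorial. This version can be used at all points near one where the fields are
smooth, hence differentiated. -/
lemma contact_of_fieldDiffAt (hX : FieldDiffAt (𝓡 (2 * n + 1)) X x)
    (hY : FieldDiffAt (𝓡 (2 * n + 1)) Y x) :
    extDeriv₁ (𝓡 (2 * n + 1)) S.η X Y x = S.g.inner x (X x) (S.φ x (Y x)) := by
  have hX' := fieldSmoothAt_extend (I := 𝓡 (2 * n + 1)) (X x)
  have hY' := fieldSmoothAt_extend (I := 𝓡 (2 * n + 1)) (Y x)
  rw [extDeriv₁_congr (fun X hX => S.mdifferentiableAt_η hX) hX hX'.fieldDiffAt (by simp)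
    hY hY'.fieldDiffAt (by simp), S.contact x _ _ hX' hY']
  simp

/-- Invariance of η under ξ: dη(ξ, X) = g(ξ, φX) = η(φX) = 0, while η(ξ) is constant. -/
lemma dirDeriv_ξ_η (hX : FieldDiffAt (𝓡 (2 * n + 1)) X x) :
    dirDeriv (𝓡 (2 * n + 1)) S.ξ (fun y => S.η y (X y)) x
      = S.η x (VectorField.mlieBracket (𝓡 (2 * n + 1)) S.ξ X x) := by
  have h := S.contact_of_fieldDiffAt (S.smooth_ξ x).fieldDiffAt hX
  rw [S.g.symm, S.inner_ξ, S.η_φ, extDeriv₁] at h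
  have e : (fun y => S.η y (S.ξ y)) = fun _ => (1 : ℝ) := funext fun y => S.η_ξ y
  rw [e] at h
  have e2 : dirDeriv (𝓡 (2 * n + 1)) X (fun _ : M => (1 : ℝ)) x = 0 := by
    rw [dirDeriv, mvfderiv_const]; rfl
  rw [e2] at h
  linarith

/-- The Reeb vector field of a Sasakian manifold preserves `φ`. -/
lemma mlieBracket_ξ_φ (hX : FieldSmoothAt (𝓡 (2 * n + 1)) X x) :
    VectorField.mlieBracket (𝓡 (2 * n + 1)) S.ξ (fun y => S.φ y (X y)) x
      = S.φ x (VectorField.mlieBracket (𝓡 (2 * n + 1)) S.ξ X x) := by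
  have h := S.normal x X S.ξ hX (S.smooth_ξ x)
  have e : (fun y => S.φ y (S.ξ y)) = 0 := funext fun y => S.φ_ξ y
  rw [S.contact x _ _ hX (S.smooth_ξ x), S.φ_ξ, map_zero, mul_zero, zero_smul, add_zero,
    nijenhuis, e, VectorField.mlieBracket_zero_right, VectorField.mlieBracket_zero_right,
    VectorField.mlieBracket_swap_apply (V := X),
    VectorField.mlieBracket_swap_apply (W := S.ξ)] at h
  simp only [Pi.zero_apply, map_zero, add_zero, sub_zero, map_neg, sub_neg_eq_add] at h
  -- Normality on (X, ξ) gives only φu = 0; invariance of η supplies ηu = 0, and then φ²u = -u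
  -- forces u = 0.
  set u := VectorField.mlieBracket (𝓡 (2 * n + 1)) S.ξ (fun y => S.φ y (X y)) x
    - S.φ x (VectorField.mlieBracket (𝓡 (2 * n + 1)) S.ξ X x) with hu
  have h1 : S.φ x u = 0 := by
    rw [hu, map_sub, ← h]; abel
  have h2 : S.η x u = 0 := by
    rw [hu, map_sub, S.η_φ, ← S.dirDeriv_ξ_η (S.smooth_φ x X hX).fieldDiffAt, sub_zero]
    have e : (fun y => S.η y (S.φ y (X y))) = fun _ => (0 : ℝ) := funext fun y => S.η_φ y _
    rw [e, dirDeriv, mvfderiv_const]; rfl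
  have h3 := S.φ_sq x u
  rw [h1, h2, map_zero, zero_smul, add_zero] at h3
  rw [← sub_eq_zero, ← hu]
  exact neg_eq_zero.1 h3.symm

/-- The Reeb vector field of a Sasakian manifold is a Killing vector field. -/
lemma dirDeriv_ξ_inner (hX : FieldSmoothAt (𝓡 (2 * n + 1)) X x)
    (hZ : FieldSmoothAt (𝓡 (2 * n + 1)) Z x) :
    dirDeriv (𝓡 (2 * n + 1)) S.ξ (fun y => S.g.inner y (X y) (Z y)) x
      = S.g.inner x (VectorField.mlieBracket (𝓡 (2 * n + 1)) S.ξ X x) (Z x)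
        + S.g.inner x (X x) (VectorField.mlieBracket (𝓡 (2 * n + 1)) S.ξ Z x) := by
  have hξ := S.smooth_ξ x
  set Y := fun y => S.φ y (X y) with hYdef
  have hY : FieldSmoothAt (𝓡 (2 * n + 1)) Y x := S.smooth_φ x X hX
  have hξY := hξ.mlieBracket hY
  have hξZ := hξ.mlieBracket hZ
  -- With Y = φX this is g(X, Z) = dη(Y, Z) + η(X)η(Z): the metric is expressed through tensors
  -- already known to be invariant under ξ.
  have e : (fun y => S.g.inner y (X y) (Z y)) =ᶠ[𝓝 x]
      ((fun _ => (1 / 2 : ℝ)) * (dirDeriv (𝓡 (2 * n + 1)) Y (fun y => S.η y (Z y))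
        - dirDeriv (𝓡 (2 * n + 1)) Z (fun y => S.η y (Y y))
        - fun y => S.η y (VectorField.mlieBracket (𝓡 (2 * n + 1)) Y Z y)))
      + (fun y => S.η y (X y)) * (fun y => S.η y (Z y)) := by
    filter_upwards [hY.eventually_fieldDiffAt, hZ.eventually_fieldDiffAt] with y h1 h2
    have h3 := S.contact_of_fieldDiffAt h1 h2
    rw [hYdef, S.compatible, ← hYdef, extDeriv₁] at h3
    simp only [Pi.add_apply, Pi.mul_apply, Pi.sub_apply]
    linarith
  have D : ∀ {Y Z}, FieldSmoothAt (𝓡 (2 * n + 1)) Y x → FieldSmoothAt (𝓡 (2 * n + 1)) Z x →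
      dirDeriv (𝓡 (2 * n + 1)) S.ξ (dirDeriv (𝓡 (2 * n + 1)) Y (fun y => S.η y (Z y))) x
      = dirDeriv (𝓡 (2 * n + 1)) (VectorField.mlieBracket (𝓡 (2 * n + 1)) S.ξ Y)
          (fun y => S.η y (Z y)) x
        + dirDeriv (𝓡 (2 * n + 1)) Y
          (fun y => S.η y (VectorField.mlieBracket (𝓡 (2 * n + 1)) S.ξ Z y)) x := by
    intro Y Z hY hZ
    rw [dirDeriv_mlieBracket (ContMDiffAt.of_le (S.smooth_η x Z hZ) two_le_infty) hξ.fieldDiffAt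
      hY.fieldDiffAt]
    have : dirDeriv (𝓡 (2 * n + 1)) Y
          (dirDeriv (𝓡 (2 * n + 1)) S.ξ (fun y => S.η y (Z y))) x = dirDeriv (𝓡 (2 * n + 1)) Y
          (fun y => S.η y (VectorField.mlieBracket (𝓡 (2 * n + 1)) S.ξ Z y)) x := by
      refine dirDeriv_congr ?_ rfl
      filter_upwards [hZ.eventually_fieldDiffAt] with y h
      exact S.dirDeriv_ξ_η h
    rw [this]; ring
  have a1 := (contMDiffAt_dirDeriv (S.smooth_η x Z hZ) hY).mdifferentiableAt (by simp)
  have a2 := (contMDiffAt_dirDeriv (S.smooth_η x Y hY) hZ).mdifferentiableAt (by simp)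
  have a3 := S.mdifferentiableAt_η (hY.mlieBracket hZ).fieldDiffAt
  have a4 := S.mdifferentiableAt_η hX.fieldDiffAt
  have a5 := S.mdifferentiableAt_η hZ.fieldDiffAt
  have key : dirDeriv (𝓡 (2 * n + 1)) S.ξ (fun y => S.g.inner y (X y) (Z y)) x
      = 1 / 2 * (dirDeriv (𝓡 (2 * n + 1)) S.ξ
          (dirDeriv (𝓡 (2 * n + 1)) Y (fun y => S.η y (Z y))) x
        - dirDeriv (𝓡 (2 * n + 1)) S.ξ (dirDeriv (𝓡 (2 * n + 1)) Z (fun y => S.η y (Y y))) x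
        - dirDeriv (𝓡 (2 * n + 1)) S.ξ
          (fun y => S.η y (VectorField.mlieBracket (𝓡 (2 * n + 1)) Y Z y)) x)
      + (S.η x (X x) * dirDeriv (𝓡 (2 * n + 1)) S.ξ (fun y => S.η y (Z y)) x
        + S.η x (Z x) * dirDeriv (𝓡 (2 * n + 1)) S.ξ (fun y => S.η y (X y)) x) := by
    rw [dirDeriv_congr e rfl]
    simp only [dirDeriv] at *
    rw [mvfderiv_add (mdifferentiableAt_const.mul ((a1.sub a2).sub a3)) (a4.mul a5),
      mvfderiv_mul mdifferentiableAt_const ((a1.sub a2).sub a3), mvfderiv_mul a4 a5,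
      mvfderiv_sub (a1.sub a2) a3, mvfderiv_sub a1 a2, mvfderiv_const]
    simp only [add_apply, smul_apply, sub_apply, smul_eq_mul, smul_zero, zero_apply]
    ring
  rw [key, D hY hZ, D hZ hY, S.dirDeriv_ξ_η (hY.mlieBracket hZ).fieldDiffAt,
    S.dirDeriv_ξ_η hZ.fieldDiffAt, S.dirDeriv_ξ_η hX.fieldDiffAt, mlieBracket_jacobi hξ hY hZ]
  -- The two halves of the Leibniz rule for dη(φX, Z); in `c1` the bracket [ξ, φX] has been replaced
  -- by φ[ξ, X].
  have c1 := S.contact_of_fieldDiffAt hξY.fieldDiffAt hZ.fieldDiffAt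
  have c2 := S.contact_of_fieldDiffAt hY.fieldDiffAt hξZ.fieldDiffAt
  rw [hYdef, S.mlieBracket_ξ_φ hX, S.compatible, ← hYdef, extDeriv₁] at c1
  rw [hYdef, S.compatible, ← hYdef, extDeriv₁] at c2
  simp only [map_add]
  linear_combination c1 + c2

/-- Three of the six terms add up to 2 dη(X, Z); the other three cancel because ξ is Killing. In
terms of the connection this says ∇_X ξ = -φX. -/
lemma koszul_ξ (hX : FieldSmoothAt (𝓡 (2 * n + 1)) X x) (hZ : FieldSmoothAt (𝓡 (2 * n + 1)) Z x) :
    koszul (𝓡 (2 * n + 1)) (fun y u v => S.g.inner y u v) X S.ξ Z x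
      = 2 * S.g.inner x (X x) (S.φ x (Z x)) := by
  have h1 := S.dirDeriv_ξ_inner hX hZ
  have h2 := S.contact x X Z hX hZ
  have e1 : (fun y => S.g.inner y (S.ξ y) (Z y)) = fun y => S.η y (Z y) :=
    funext fun y => by rw [S.g.symm, S.inner_ξ]
  rw [extDeriv₁] at h2
  rw [S.isSmoothMetric.inner_comm_fun X Z] at h1
  simp only [koszul, e1, S.inner_ξ]
  rw [VectorField.mlieBracket_swap_apply (V := X) (W := S.ξ), map_neg, neg_apply, h1,
    S.g.symm x (X x)]
  linarith

end SasakianStructure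

/-! ### Vector fields along an immersion -/

section Immersion

variable {E : Type*} [NormedAddCommGroup E] [NormedSpace ℝ E] [FiniteDimensional ℝ E]
  {H : Type*} [TopologicalSpace H] {I : ModelWithCorners ℝ E H} [I.Boundaryless]
  {M : Type*} [TopologicalSpace M] [ChartedSpace H M] [IsManifold I ∞ M]
  {E' : Type*} [NormedAddCommGroup E'] [NormedSpace ℝ E'] [FiniteDimensional ℝ E']
  {H' : Type*} [TopologicalSpace H'] {I' : ModelWithCorners ℝ E' H'} [I'.Boundaryless]
  {N : Type*} [TopologicalSpace N] [ChartedSpace H' N] [IsManifold I' ∞ N]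
  {i : N → M}

/-- Near a point where `i` is an immersion, smooth functions on the source factor through `i`. -/
lemma exists_contMDiffAt_comp_eq {F : Type*} [NormedAddCommGroup F] [NormedSpace ℝ F]
    (hi : ContMDiff I' I ∞ i) {y : N} (hinj : Function.Injective (mfderiv I' I i y)) {c : N → F}
    (hc : ContMDiffAt I' 𝓘(ℝ, F) ∞ c y) :
    ∃ c' : M → F, ContMDiffAt I 𝓘(ℝ, F) ∞ c' (i y) ∧ ∀ᶠ z in 𝓝 y, c' (i z) = c z := by
  have : IsManifold I 1 M := inferInstance
  have : IsManifold I' 1 N := inferInstance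
  have : CompleteSpace E' := FiniteDimensional.complete ℝ E'
  set φ := extChartAt I' y
  set ψ := extChartAt I (i y)
  have hys : y ∈ φ.source := mem_extChartAt_source y
  have hψinv := isInvertible_mfderiv_extChartAt (I := I) (mem_extChartAt_source (I := I) (i y))
  let D : E' →L[ℝ] E := (mfderiv I 𝓘(ℝ, E) ψ (i y)).comp (mfderiv I' I i y)
  have hD : Function.Injective D := hψinv.injective.comp hinj
  -- A linear left inverse of the differential, composed with the chart of `M`, gives a map `h` for
  -- which d(h ∘ i) is the identity at `y`. The inverse function theorem then applies to h ∘ i read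
  -- in the chart of `N`.
  obtain ⟨P₀, hP₀⟩ := (D : E' →ₗ[ℝ] E).exists_leftInverse_of_injective (LinearMap.ker_eq_bot.2 hD)
  let P : E →L[ℝ] E' := LinearMap.toContinuousLinearMap P₀
  have hP : ∀ v, P (D v) = v := fun v => congrArg (fun f => f v) hP₀
  let h : M → E' := P ∘ ψ
  have hψs : ContMDiffAt I 𝓘(ℝ, E) ∞ ψ (i y) := contMDiffAt_extChartAt
  have hh : ContMDiffAt I 𝓘(ℝ, E') ∞ h (i y) :=
    (P.contDiff.contMDiff.contMDiffAt).comp (i y) hψs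
  have hφsymm : ContMDiffAt 𝓘(ℝ, E') I' ∞ φ.symm (φ y) := by
    have := (contMDiffWithinAt_extChartAt_symm_range (n := ∞) y (mem_extChartAt_target (I := I') y))
    rwa [I'.range_eq_univ, contMDiffWithinAt_univ] at this
  have hsy : φ.symm (φ y) = y := φ.left_inv hys
  have hhi : ContMDiffAt I' 𝓘(ℝ, E') ∞ (h ∘ i) y := hh.comp y (hi y)
  let k : E' → E' := (h ∘ i) ∘ φ.symm
  have hk' : ContMDiffAt 𝓘(ℝ, E') 𝓘(ℝ, E') ∞ k (φ y) := hhi.comp_of_eq hφsymm hsy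
  have hk : ContDiffAt ℝ ∞ k (φ y) := hk'.contDiffAt
  have hdi : ∀ v, mfderiv I' 𝓘(ℝ, E') (h ∘ i) y v = v := by
    intro v
    rw [mfderiv_comp y (hh.mdifferentiableAt (by simp)) ((hi y).mdifferentiableAt (by simp))]
    have e : mfderiv I 𝓘(ℝ, E') h (i y) = P.comp (mfderiv I 𝓘(ℝ, E) ψ (i y)) := by
      have := mfderiv_comp (I' := 𝓘(ℝ, E)) (i y) (P.mdifferentiableAt) (hψs.mdifferentiableAt (by simp))
      rw [P.mfderiv_eq] at this
      exact this
    rw [e]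
    exact hP v
  have hsinv := isInvertible_mfderivWithin_extChartAt_symm (I := I') (mem_extChartAt_target (I := I') y)
  rw [I'.range_eq_univ, mfderivWithin_univ] at hsinv
  obtain ⟨e, he⟩ := hsinv
  let e' : E' ≃L[ℝ] E' := e
  have hkd : HasFDerivAt k (e' : E' →L[ℝ] E') (φ y) := by
    have h1 : MDifferentiableAt I' 𝓘(ℝ, E') (h ∘ i) (φ.symm (φ y)) := by
      rw [hsy]; exact hhi.mdifferentiableAt (by simp)
    have h2 := mfderiv_comp (φ y) h1 (hφsymm.mdifferentiableAt (by simp))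
    have h3 : fderiv ℝ k (φ y) = (e' : E' →L[ℝ] E') := by
      rw [← mfderiv_eq_fderiv]
      refine h2.trans ?_
      ext1 v
      change mfderiv I' 𝓘(ℝ, E') (h ∘ i) (φ.symm (φ y)) (mfderiv 𝓘(ℝ, E') I' φ.symm (φ y) v) = e v
      have h4 : ∀ w : E', mfderiv I' 𝓘(ℝ, E') (h ∘ i) (φ.symm (φ y)) w = w := by
        rw [hsy]; exact hdi
      rw [← he]
      exact h4 _
    rw [← h3]
    exact (hk.differentiableAt (by simp)).hasFDerivAt
  let s := hk.localInverse hkd (by simp)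
  have hs : ContDiffAt ℝ ∞ s (k (φ y)) := hk.to_localInverse hkd (by simp)
  have hsk : ∀ᶠ z in 𝓝 (φ y), s (k z) = z :=
    (hk.hasStrictFDerivAt' hkd (by simp)).eventually_left_inverse
  have hky : k (φ y) = h (i y) := congrArg (h ∘ i) hsy
  have hs0 : s (h (i y)) = φ y := by rw [← hky]; exact hsk.self_of_nhds
  -- Near `y` the map φ.symm ∘ s ∘ h is a left inverse of `i`.
  refine ⟨((c ∘ φ.symm) ∘ s) ∘ h, ?_, ?_⟩
  · rw [hky] at hs
    refine ContMDiffAt.comp (i y) (ContMDiffAt.comp (h (i y)) ?_ hs.contMDiffAt) hh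
    rw [hs0]
    exact hc.comp_of_eq hφsymm hsy
  · have hcont : ContinuousAt φ y := continuousAt_extChartAt y
    filter_upwards [hcont.eventually hsk, (isOpen_extChartAt_source (I := I') y).mem_nhds hys]
      with z hz hzs
    have e1 : φ.symm (φ z) = z := φ.left_inv hzs
    have e2 : k (φ z) = h (i z) := congrArg (h ∘ i) e1
    rw [e2] at hz
    simp only [Function.comp]
    change c (φ.symm (s (h (i z)))) = c z
    rw [hz, e1]

variable {X Y Z : Π y : N, TangentSpace I' y} {y : N}

/-- Vector fields on the source of an immersion are locally related to vector fields on the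
target. -/
lemma exists_related (hi : ContMDiff I' I ∞ i) (hinj : Function.Injective (mfderiv I' I i y))
    (hX : FieldSmoothAt I' X y) :
    ∃ X' : Π x : M, TangentSpace I x, FieldSmoothAt I X' (i y) ∧
      ∀ᶠ z in 𝓝 y, X' (i z) = mfderiv I' I i z (X z) := by
  let t := trivializationAt E (TangentSpace I : M → Type _) (i y)
  have h1 := (Bundle.contMDiffAt_totalSpace.1 (hX.mfderiv_apply (hi y))).2
  obtain ⟨c, hc, hce⟩ := exists_contMDiffAt_comp_eq hi hinj h1
  have hmem : i y ∈ t.baseSet := FiberBundle.mem_baseSet_trivializationAt' (i y)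
  refine ⟨fun p => t.symm p (c p), ?_, ?_⟩
  · refine (Bundle.contMDiffAt_section (i y)).2 ?_
    refine hc.congr_of_eventuallyEq ?_
    filter_upwards [t.open_baseSet.mem_nhds hmem] with p hp
    exact congrArg Prod.snd (t.apply_mk_symm hp (c p))
  · filter_upwards [hce, hi.continuous.continuousAt.preimage_mem_nhds
      (t.open_baseSet.mem_nhds hmem)] with z hz hzm
    rw [hz]
    exact t.symm_apply_apply_mk hzm _

variable {X' Y' Z' : Π x : M, TangentSpace I x}

lemma dirDeriv_comp (hi : ContMDiff I' I ∞ i) {f : M → ℝ}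
    (hf : MDifferentiableAt I 𝓘(ℝ, ℝ) f (i y)) (h : X' (i y) = mfderiv I' I i y (X y)) :
    dirDeriv I' X (fun z => f (i z)) y = dirDeriv I X' f (i y) := by
  rw [dirDeriv, dirDeriv, h]
  exact mvfderiv_comp_apply y hf ((hi y).mdifferentiableAt (by simp)) (X y)

/-- The Lie brackets of related vector fields are related. -/
lemma mfderiv_mlieBracket (hi : ContMDiff I' I ∞ i) (hX : FieldSmoothAt I' X y)
    (hY : FieldSmoothAt I' Y y) (hX' : FieldSmoothAt I X' (i y)) (hY' : FieldSmoothAt I Y' (i y))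
    (hXX : ∀ᶠ z in 𝓝 y, X' (i z) = mfderiv I' I i z (X z))
    (hYY : ∀ᶠ z in 𝓝 y, Y' (i z) = mfderiv I' I i z (Y z)) :
    mfderiv I' I i y (VectorField.mlieBracket I' X Y y)
      = VectorField.mlieBracket I X' Y' (i y) := by
  have : IsManifold I 1 M := inferInstance
  have : CompleteSpace E' := FiniteDimensional.complete ℝ E'
  have : CompleteSpace E := FiniteDimensional.complete ℝ E
  -- Both vectors act on functions as commutators of derivations, and derivatives along related
  -- fields commute with pullback by `i`.
  have key : ∀ f : M → ℝ, ContMDiffAt I 𝓘(ℝ, ℝ) ∞ f (i y) →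
      mvfderiv I f (i y) (mfderiv I' I i y (VectorField.mlieBracket I' X Y y))
        = mvfderiv I f (i y) (VectorField.mlieBracket I X' Y' (i y)) := by
    intro f hf
    have hfi : ContMDiffAt I' 𝓘(ℝ, ℝ) ∞ (fun z => f (i z)) y := hf.comp y (hi y)
    have h1 := dirDeriv_mlieBracket (ContMDiffAt.of_le hfi two_le_infty) hX.fieldDiffAt
      hY.fieldDiffAt
    have h2 := dirDeriv_mlieBracket (ContMDiffAt.of_le hf two_le_infty) hX'.fieldDiffAt
      hY'.fieldDiffAt
    have hev : ∀ᶠ z in 𝓝 y, MDifferentiableAt I 𝓘(ℝ, ℝ) f (i z) :=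
      hi.continuous.continuousAt.eventually (eventually_mdifferentiableAt hf)
    have A : ∀ {V W : Π y : N, TangentSpace I' y} {V' W' : Π x : M, TangentSpace I x},
        FieldSmoothAt I W' (i y) →
        (∀ᶠ z in 𝓝 y, V' (i z) = mfderiv I' I i z (V z)) →
        (∀ᶠ z in 𝓝 y, W' (i z) = mfderiv I' I i z (W z)) →
        dirDeriv I' V (dirDeriv I' W fun z => f (i z)) y
          = dirDeriv I V' (dirDeriv I W' f) (i y) := by
      intro V W V' W' hW' hV hW
      rw [← dirDeriv_comp hi ((contMDiffAt_dirDeriv hf hW').mdifferentiableAt (by simp))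
        hV.self_of_nhds]
      refine dirDeriv_congr ?_ rfl
      filter_upwards [hev, hW] with z h3 h4
      exact dirDeriv_comp hi h3 h4
    rw [A hY' hXX hYY, A hX' hYY hXX, ← h2] at h1
    have h3 : dirDeriv I' (VectorField.mlieBracket I' X Y) (fun z => f (i z)) y
        = mvfderiv I f (i y) (mfderiv I' I i y (VectorField.mlieBracket I' X Y y)) :=
      mvfderiv_comp_apply y (hf.mdifferentiableAt (by simp))
        ((hi y).mdifferentiableAt (by simp)) _
    rw [← h3, h1, dirDeriv]
  have hψs : ContMDiffAt I 𝓘(ℝ, E) ∞ (extChartAt I (i y)) (i y) := contMDiffAt_extChartAt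
  have hψinv := isInvertible_mfderiv_extChartAt (I := I) (mem_extChartAt_source (I := I) (i y))
  -- Linear functionals of the chart are enough test functions to separate tangent vectors.
  refine hψinv.injective ?_
  refine (SeparatingDual.eq_iff_forall_dual_eq (R := ℝ) (V := E)).2 fun L => ?_
  have hL := key (L ∘ extChartAt I (i y)) (L.contDiff.contMDiff.contMDiffAt.comp (i y) hψs)
  have e : ∀ v : TangentSpace I (i y), mvfderiv I (L ∘ extChartAt I (i y)) (i y) v
      = L (mfderiv I 𝓘(ℝ, E) (extChartAt I (i y)) (i y) v) := by
    intro v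
    have := mfderiv_comp (I' := 𝓘(ℝ, E)) (i y) (L.mdifferentiableAt)
      (hψs.mdifferentiableAt (by simp))
    rw [L.mfderiv_eq] at this
    exact congrArg (fun T => T v) this
  rwa [e, e] at hL

end Immersion

/-! ### The geometry induced on a hypersurface -/

section Hypersurface

variable {n : ℕ} {M : Type*} [TopologicalSpace M]
  [ChartedSpace (EuclideanSpace ℝ (Fin (2 * n + 1))) M] [IsManifold (𝓡 (2 * n + 1)) ∞ M]
  {N : Type*} [TopologicalSpace N]
  [ChartedSpace (EuclideanSpace ℝ (Fin (2 * n))) N] [IsManifold (𝓡 (2 * n)) ∞ N]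
  (S : SasakianStructure n M) (i : N → M)

/-- The induced metric, as a field of continuous bilinear forms. -/
def inducedForm (y : N) :
    TangentSpace (𝓡 (2 * n)) y →L[ℝ] TangentSpace (𝓡 (2 * n)) y →L[ℝ] ℝ :=
  (ContinuousLinearMap.precomp ℝ (mfderiv (𝓡 (2 * n)) (𝓡 (2 * n + 1)) i y)).comp
    ((S.g.inner (i y)).comp (mfderiv (𝓡 (2 * n)) (𝓡 (2 * n + 1)) i y))

variable {i}

lemma IsSmoothMetric.inner_neg_left {E : Type*} [NormedAddCommGroup E] [NormedSpace ℝ E]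
    {H : Type*} [TopologicalSpace H] {I : ModelWithCorners ℝ E H}
    {M : Type*} [TopologicalSpace M] [ChartedSpace H M] [IsManifold I ∞ M]
    {g : Π x : M, TangentSpace I x →L[ℝ] TangentSpace I x →L[ℝ] ℝ} (hg : IsSmoothMetric g) {x : M}
    (u v : TangentSpace I x) : g x (-u) v = - g x u v := by
  rw [hg.symm, map_neg, hg.symm]

lemma inducedForm_apply (y : N) (u v : TangentSpace (𝓡 (2 * n)) y) :
    inducedForm S i y u v = S.g.inner (i y) (mfderiv (𝓡 (2 * n)) (𝓡 (2 * n + 1)) i y u)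
      (mfderiv (𝓡 (2 * n)) (𝓡 (2 * n + 1)) i y v) := rfl

lemma isSmoothMetric_inducedForm (hi : IsHypersurface (n := n) i) :
    IsSmoothMetric (I := 𝓡 (2 * n)) (inducedForm S i) where
  symm _ _ _ := S.g.symm _ _ _
  pos y _ hu := S.g.pos _ _ fun h => hu (hi.injective_mfderiv y (h.trans (map_zero _).symm))
  diff _ _ _ hX hY :=
    mdifferentiableAt_inner_along S.g (hX.mfderiv_apply hi.smooth) (hY.mfderiv_apply hi.smooth)
  smooth x _ _ hX hY := contMDiffAt_inner_along S.g (hX.mfderiv_apply (hi.smooth x))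
    (hY.mfderiv_apply (hi.smooth x))

/-- Koszul's expression is built from scalar products, their derivatives and brackets, each of which
is preserved for related fields. This carries information from `M` to `N` without comparing the two
connections. -/
lemma koszul_inducedForm (hi : IsHypersurface (n := n) i)
    {X Y Z : Π y : N, TangentSpace (𝓡 (2 * n)) y}
    {X' Y' Z' : Π x : M, TangentSpace (𝓡 (2 * n + 1)) x} {y : N}
    (hX : FieldSmoothAt (𝓡 (2 * n)) X y) (hY : FieldSmoothAt (𝓡 (2 * n)) Y y)
    (hZ : FieldSmoothAt (𝓡 (2 * n)) Z y) (hX' : FieldSmoothAt (𝓡 (2 * n + 1)) X' (i y))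
    (hY' : FieldSmoothAt (𝓡 (2 * n + 1)) Y' (i y)) (hZ' : FieldSmoothAt (𝓡 (2 * n + 1)) Z' (i y))
    (hXX : ∀ᶠ z in 𝓝 y, X' (i z) = mfderiv (𝓡 (2 * n)) (𝓡 (2 * n + 1)) i z (X z))
    (hYY : ∀ᶠ z in 𝓝 y, Y' (i z) = mfderiv (𝓡 (2 * n)) (𝓡 (2 * n + 1)) i z (Y z))
    (hZZ : ∀ᶠ z in 𝓝 y, Z' (i z) = mfderiv (𝓡 (2 * n)) (𝓡 (2 * n + 1)) i z (Z z)) :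
    koszul (𝓡 (2 * n)) (fun y u v => inducedForm S i y u v) X Y Z y
      = koszul (𝓡 (2 * n + 1)) (fun y u v => S.g.inner y u v) X' Y' Z' (i y) := by
  have A : ∀ {U V W : Π y : N, TangentSpace (𝓡 (2 * n)) y}
      {U' V' W' : Π x : M, TangentSpace (𝓡 (2 * n + 1)) x},
      FieldSmoothAt (𝓡 (2 * n + 1)) V' (i y) → FieldSmoothAt (𝓡 (2 * n + 1)) W' (i y) →
      (∀ᶠ z in 𝓝 y, U' (i z) = mfderiv (𝓡 (2 * n)) (𝓡 (2 * n + 1)) i z (U z)) →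
      (∀ᶠ z in 𝓝 y, V' (i z) = mfderiv (𝓡 (2 * n)) (𝓡 (2 * n + 1)) i z (V z)) →
      (∀ᶠ z in 𝓝 y, W' (i z) = mfderiv (𝓡 (2 * n)) (𝓡 (2 * n + 1)) i z (W z)) →
      dirDeriv (𝓡 (2 * n)) U (fun z => inducedForm S i z (V z) (W z)) y
        = dirDeriv (𝓡 (2 * n + 1)) U' (fun p => S.g.inner p (V' p) (W' p)) (i y) := by
    intro U V W U' V' W' hV hW hU hVV hWW
    rw [← dirDeriv_comp (X := U) hi.smooth
      (S.isSmoothMetric.diff _ _ _ hV.fieldDiffAt hW.fieldDiffAt) hU.self_of_nhds]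
    refine dirDeriv_congr ?_ rfl
    filter_upwards [hVV, hWW] with z h1 h2
    rw [inducedForm_apply, h1, h2]
  unfold koszul
  rw [A hY' hZ' hXX hYY hZZ, A hZ' hX' hYY hZZ hXX, A hX' hY' hZZ hXX hYY]
  simp only [inducedForm_apply]
  rw [mfderiv_mlieBracket hi.smooth hX hY hX' hY' hXX hYY,
    mfderiv_mlieBracket hi.smooth hX hZ hX' hZ' hXX hZZ,
    mfderiv_mlieBracket hi.smooth hY hZ hY' hZ' hYY hZZ,
    hXX.self_of_nhds, hYY.self_of_nhds, hZZ.self_of_nhds]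

/-! ### The Reeb field on the hypersurface and its covariant derivative -/

section Reeb

variable (hi : IsHypersurface (n := n) i) {ξ : Π y : N, TangentSpace (𝓡 (2 * n)) y}
  (hξ : ∀ y : N, mfderiv (𝓡 (2 * n)) (𝓡 (2 * n + 1)) i y (ξ y) = S.ξ (i y))
include hi hξ

/-- Here `ξ` is given only pointwise, by its images in `M`; its scalar products with smooth fields
are smooth, which is enough. -/
lemma fieldSmoothAt_reeb (y : N) : FieldSmoothAt (𝓡 (2 * n)) ξ y := by
  refine (isSmoothMetric_inducedForm S hi).fieldSmoothAt_of_inner fun Z hZ => ?_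
  simp only [inducedForm_apply, hξ]
  exact contMDiffAt_inner_along S.g ((S.smooth_ξ (i y)).comp y (hi.smooth y))
    (hZ.mfderiv_apply (hi.smooth y))

/-- On a hypersurface tangent to the Reeb field, `∇ξ` is minus the tangential part of `φ`. -/
lemma inner_nabla_reeb (y : N) (v w : TangentSpace (𝓡 (2 * n)) y) :
    inducedForm S i y (nabla (inducedForm S i) ξ y v) w
      = - S.g.inner (i y) (S.φ (i y) (mfderiv (𝓡 (2 * n)) (𝓡 (2 * n + 1)) i y v))
        (mfderiv (𝓡 (2 * n)) (𝓡 (2 * n + 1)) i y w) := by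
  have hg := isSmoothMetric_inducedForm S hi
  have hξs := fieldSmoothAt_reeb S hi hξ y
  have hv := fieldSmoothAt_extend (I := 𝓡 (2 * n)) v
  have hw := fieldSmoothAt_extend (I := 𝓡 (2 * n)) w
  obtain ⟨X', hX', hXX⟩ := exists_related hi.smooth (hi.injective_mfderiv y) hv
  obtain ⟨Z', hZ', hZZ⟩ := exists_related hi.smooth (hi.injective_mfderiv y) hw
  have h1 := hg.koszul_cov hv.fieldDiffAt hξs.fieldDiffAt hw.fieldDiffAt
  rw [koszul_inducedForm S hi hv hξs hw hX' (S.smooth_ξ _) hZ' hXX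
    (Filter.Eventually.of_forall fun z => (hξ z).symm) hZZ, S.koszul_ξ hX' hZ',
    hXX.self_of_nhds, hZZ.self_of_nhds, ← hg.nabla_apply_extend hξs.fieldDiffAt,
    FiberBundle.extend_apply_self, FiberBundle.extend_apply_self] at h1
  rw [S.inner_φ_left]
  linarith

lemma nabla_reeb_skew (y : N) (v w : TangentSpace (𝓡 (2 * n)) y) :
    inducedForm S i y (nabla (inducedForm S i) ξ y v) w
      = - inducedForm S i y v (nabla (inducedForm S i) ξ y w) := by
  rw [inner_nabla_reeb S hi hξ, (isSmoothMetric_inducedForm S hi).symm, inner_nabla_reeb S hi hξ,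
    S.inner_φ_left, S.g.symm]

lemma nabla_reeb_reeb (y : N) : nabla (inducedForm S i) ξ y (ξ y) = 0 := by
  refine (isSmoothMetric_inducedForm S hi).ext_inner fun w => ?_
  rw [inner_nabla_reeb S hi hξ, hξ, S.φ_ξ]
  simp

lemma mfderiv_nabla_reeb {y : N} {v : TangentSpace (𝓡 (2 * n)) y} (hv : v ∈ holTangent S i y) :
    mfderiv (𝓡 (2 * n)) (𝓡 (2 * n + 1)) i y (nabla (inducedForm S i) ξ y v)
      = - S.φ (i y) (mfderiv (𝓡 (2 * n)) (𝓡 (2 * n + 1)) i y v) := by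
  obtain ⟨Z, hZ⟩ := hv.2
  have : nabla (inducedForm S i) ξ y v = -Z := by
    refine (isSmoothMetric_inducedForm S hi).ext_inner fun w => ?_
    rw [inner_nabla_reeb S hi hξ, ← hZ,
      (isSmoothMetric_inducedForm S hi).inner_neg_left, inducedForm_apply]
  rw [this, map_neg, hZ]

lemma holJ_eq {y : N} {v : TangentSpace (𝓡 (2 * n)) y} (hv : v ∈ holTangent S i y) :
    holJ S i y v = - nabla (inducedForm S i) ξ y v := by
  refine hi.injective_mfderiv y ?_
  rw [holJ, dif_pos hv.2, map_neg, mfderiv_nabla_reeb S hi hξ hv, neg_neg]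
  exact hv.2.choose_spec

lemma nabla_reeb_nabla_reeb {y : N} {v : TangentSpace (𝓡 (2 * n)) y}
    (hv : v ∈ holTangent S i y) :
    nabla (inducedForm S i) ξ y (nabla (inducedForm S i) ξ y v) = - v := by
  refine (isSmoothMetric_inducedForm S hi).ext_inner fun w => ?_
  have h : S.η (i y) (mfderiv (𝓡 (2 * n)) (𝓡 (2 * n + 1)) i y v) = 0 := by
    rw [← S.inner_ξ]; exact hv.1
  rw [inner_nabla_reeb S hi hξ, mfderiv_nabla_reeb S hi hξ hv, map_neg, S.φ_sq, h, zero_smul,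
    add_zero, neg_neg, (isSmoothMetric_inducedForm S hi).inner_neg_left, inducedForm_apply]

omit hi hξ in
lemma finrank_tangentSpace {k : ℕ} {P : Type*} [TopologicalSpace P]
    [ChartedSpace (EuclideanSpace ℝ (Fin k)) P] (p : P) :
    Module.finrank ℝ (TangentSpace (𝓡 k) p) = k :=
  finrank_euclideanSpace_fin

omit hξ in
lemma exists_normal (y : N) : ∃ ν : TangentSpace (𝓡 (2 * n + 1)) (i y), ν ≠ 0 ∧
    ∀ v, S.g.inner (i y) (mfderiv (𝓡 (2 * n)) (𝓡 (2 * n + 1)) i y v) ν = 0 := by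
  have : FiniteDimensional ℝ (TangentSpace (𝓡 (2 * n)) y) :=
    inferInstanceAs (FiniteDimensional ℝ (EuclideanSpace ℝ (Fin (2 * n))))
  have : FiniteDimensional ℝ (TangentSpace (𝓡 (2 * n + 1)) (i y)) :=
    inferInstanceAs (FiniteDimensional ℝ (EuclideanSpace ℝ (Fin (2 * n + 1))))
  let L : TangentSpace (𝓡 (2 * n + 1)) (i y) →ₗ[ℝ] Module.Dual ℝ (TangentSpace (𝓡 (2 * n)) y) :=
    { toFun := fun ν => ((S.g.inner (i y) ν).comp
        (mfderiv (𝓡 (2 * n)) (𝓡 (2 * n + 1)) i y)).toLinearMap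
      map_add' := fun a b => by ext v; simp
      map_smul' := fun a b => by ext v; simp }
  have hker : LinearMap.ker L ≠ ⊥ := by
    refine LinearMap.ker_ne_bot_of_finrank_lt ?_
    rw [Subspace.dual_finrank_eq, finrank_tangentSpace, finrank_tangentSpace]
    omega
  obtain ⟨ν, hν, hν0⟩ := (Submodule.ne_bot_iff _).1 hker
  exact ⟨ν, hν0, fun v => (S.g.symm _ _ _).trans
    (congrArg (fun f => f v) (LinearMap.mem_ker.1 hν))⟩

omit hξ in
-- The image of the differential lies in the hyperplane orthogonal to ν and has the same dimension
-- 2n.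
lemma exists_mfderiv_eq {y : N} {ν : TangentSpace (𝓡 (2 * n + 1)) (i y)} (hν0 : ν ≠ 0)
    (hν : ∀ v, S.g.inner (i y) (mfderiv (𝓡 (2 * n)) (𝓡 (2 * n + 1)) i y v) ν = 0)
    {w : TangentSpace (𝓡 (2 * n + 1)) (i y)} (hw : S.g.inner (i y) w ν = 0) :
    ∃ u, mfderiv (𝓡 (2 * n)) (𝓡 (2 * n + 1)) i y u = w := by
  have : FiniteDimensional ℝ (TangentSpace (𝓡 (2 * n)) y) :=
    inferInstanceAs (FiniteDimensional ℝ (EuclideanSpace ℝ (Fin (2 * n))))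
  have : FiniteDimensional ℝ (TangentSpace (𝓡 (2 * n + 1)) (i y)) :=
    inferInstanceAs (FiniteDimensional ℝ (EuclideanSpace ℝ (Fin (2 * n + 1))))
  let D := (mfderiv (𝓡 (2 * n)) (𝓡 (2 * n + 1)) i y).toLinearMap
  let ℓ := (S.g.inner (i y) ν).toLinearMap
  have hℓ : ∀ w : TangentSpace (𝓡 (2 * n + 1)) (i y), ℓ w = S.g.inner (i y) w ν :=
    fun w => S.g.symm _ _ _
  have hle : LinearMap.range D ≤ LinearMap.ker ℓ := by
    rintro _ ⟨v, rfl⟩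
    exact (hℓ _).trans (hν v)
  have h1 : Module.finrank ℝ (LinearMap.range D) = 2 * n := by
    rw [LinearMap.finrank_range_of_inj (hi.injective_mfderiv y), finrank_tangentSpace]
  have h2 : Module.finrank ℝ (LinearMap.range ℓ) + Module.finrank ℝ (LinearMap.ker ℓ)
      = 2 * n + 1 := by
    rw [LinearMap.finrank_range_add_finrank_ker, finrank_tangentSpace]
  have h3 : 1 ≤ Module.finrank ℝ (LinearMap.range ℓ) := by
    rw [Submodule.one_le_finrank_iff, ne_eq, LinearMap.range_eq_bot]
    intro h0
    have := S.g.pos _ ν hν0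
    rw [← hℓ ν, h0] at this
    exact lt_irrefl _ this
  have heq := Submodule.eq_of_le_of_finrank_le hle (by omega)
  have : w ∈ LinearMap.range D := by
    rw [heq]; exact (hℓ w).trans hw
  exact this

lemma η_normal {y : N} {ν : TangentSpace (𝓡 (2 * n + 1)) (i y)}
    (hν : ∀ v, S.g.inner (i y) (mfderiv (𝓡 (2 * n)) (𝓡 (2 * n + 1)) i y v) ν = 0) :
    S.η (i y) ν = 0 := by
  rw [← S.inner_ξ, S.g.symm, ← hξ, hν]

omit hξ in
lemma exists_mfderiv_eq_φ {y : N} {ν : TangentSpace (𝓡 (2 * n + 1)) (i y)} (hν0 : ν ≠ 0)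
    (hν : ∀ v, S.g.inner (i y) (mfderiv (𝓡 (2 * n)) (𝓡 (2 * n + 1)) i y v) ν = 0) :
    ∃ u, mfderiv (𝓡 (2 * n)) (𝓡 (2 * n + 1)) i y u = S.φ (i y) ν := by
  refine exists_mfderiv_eq S hi hν0 hν ?_
  have h := S.inner_φ_left (i y) ν ν
  rw [S.g.symm (i y) ν] at h
  linarith

/-- The image of the skew map A = ∇ξ is orthogonal to ξ because Aξ = 0. Also g(Av, φν) = -g(φv, φν)
= 0 by compatibility, so φ(Av) has no normal component. This holds at every point, so A produces
smooth sections of HN. -/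
lemma nabla_reeb_mem (y : N) (v : TangentSpace (𝓡 (2 * n)) y) :
    nabla (inducedForm S i) ξ y v ∈ holTangent S i y := by
  obtain ⟨ν, hν0, hν⟩ := exists_normal S hi y
  obtain ⟨u, hu⟩ := exists_mfderiv_eq_φ S hi hν0 hν
  constructor
  · rw [← hξ]
    change inducedForm S i y (nabla (inducedForm S i) ξ y v) (ξ y) = 0
    rw [nabla_reeb_skew S hi hξ, nabla_reeb_reeb S hi hξ, map_zero, neg_zero]
  · refine exists_mfderiv_eq S hi hν0 hν ?_
    rw [S.inner_φ_left, ← hu]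
    change - inducedForm S i y (nabla (inducedForm S i) ξ y v) u = 0
    rw [inner_nabla_reeb S hi hξ, hu, S.compatible, hν, η_normal S hi hξ hν]
    simp

/-- The Levi form in terms of the covariant derivative of `∇ξ`. -/
lemma leviForm_eq {x : N} {ν : TangentSpace (𝓡 (2 * n + 1)) (i x)}
    {U : TangentSpace (𝓡 (2 * n)) x}
    (hU : mfderiv (𝓡 (2 * n)) (𝓡 (2 * n + 1)) i x U = S.φ (i x) ν)
    (hAU : nabla (inducedForm S i) ξ x U = 0)
    {X Y : TangentSpace (𝓡 (2 * n)) x} (hX : X ∈ holTangent S i x) (hY : Y ∈ holTangent S i x) :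
    leviForm S i x ν X Y
      = - inducedForm S i x (nablaEnd (inducedForm S i) (nabla (inducedForm S i) ξ) x X Y) U
        - inducedForm S i x (nablaEnd (inducedForm S i) (nabla (inducedForm S i) ξ) x
          (nabla (inducedForm S i) ξ x Y) (nabla (inducedForm S i) ξ x X)) U := by
  have hg := isSmoothMetric_inducedForm S hi
  have hξs := fieldSmoothAt_reeb S hi hξ
  have hA := nabla_reeb_skew S hi hξ
  set A := nabla (inducedForm S i) ξ with hAdef
  have hAs : ∀ Z, FieldSmoothAt (𝓡 (2 * n)) Z x → FieldSmoothAt (𝓡 (2 * n)) (fun y => A y (Z y)) x :=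
    fun Z hZ => hg.fieldSmoothAt_nabla hZ (hξs x)
  -- As A² = -1 on HN, applying A to any smooth extension of -AX gives a section of HN through X.
  have hex : ∀ X ∈ holTangent S i x, ∃ F : Π y : N, TangentSpace (𝓡 (2 * n)) y,
      FieldSmoothAt (𝓡 (2 * n)) F x ∧ (∀ᶠ y in 𝓝 x, F y ∈ holTangent S i y) ∧ F x = X := by
    intro X hX
    refine ⟨fun y => A y (FiberBundle.extend _ (-A x X) y), hAs _ (fieldSmoothAt_extend _),
      Filter.Eventually.of_forall fun y => nabla_reeb_mem S hi hξ y _, ?_⟩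
    change A x (FiberBundle.extend _ (-A x X) x) = X
    rw [FiberBundle.extend_apply_self, map_neg, nabla_reeb_nabla_reeb S hi hξ hX, neg_neg]
  have h : ∃ F : (Π y : N, TangentSpace (𝓡 (2 * n)) y) × (Π y : N, TangentSpace (𝓡 (2 * n)) y),
      FieldSmoothAt (𝓡 (2 * n)) F.1 x ∧ FieldSmoothAt (𝓡 (2 * n)) F.2 x ∧
      (∀ᶠ y in 𝓝 x, F.1 y ∈ holTangent S i y ∧ F.2 y ∈ holTangent S i y) ∧
      F.1 x = X ∧ F.2 x = Y := by
    obtain ⟨F₁, a1, b1, c1⟩ := hex X hX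
    obtain ⟨F₂, a2, b2, c2⟩ := hex Y hY
    exact ⟨(F₁, F₂), a1, a2, b1.and b2, c1, c2⟩
  rw [leviForm, scalarLeviForm, dif_pos h]
  obtain ⟨s1, s2, hm, e1, e2⟩ := h.choose_spec
  -- From here the sections are arbitrary, so the computation covers whichever ones the definition
  -- picked.
  generalize h.choose = F at s1 s2 hm e1 e2 ⊢
  obtain ⟨F₁, F₂⟩ := F
  simp only at s1 s2 hm e1 e2 ⊢
  have hJ : (fun y => holJ S i y (F₂ y)) =ᶠ[𝓝 x] fun y => - A y (F₂ y) := by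
    filter_upwards [hm] with y hy using holJ_eq S hi hξ hy.2
  have hAF₂ := (hAs _ s2).fieldDiffAt
  have hAF₁ := (hAs _ s1).fieldDiffAt
  have hAAF₁ : FieldDiffAt (𝓡 (2 * n)) (fun y => A y (A y (F₁ y))) x := (hAs _ (hAs _ s1)).fieldDiffAt
  have hbr : VectorField.mlieBracket (𝓡 (2 * n)) F₁ (fun y => holJ S i y (F₂ y)) x
      = - nabla (inducedForm S i) (fun y => A y (F₂ y)) x X
        + nabla (inducedForm S i) F₁ x (A x Y) := by
    rw [(Filter.EventuallyEq.refl (𝓝 x) F₁).mlieBracket_vectorField_eq hJ,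
      ← hg.cov_sub_cov s1.fieldDiffAt hAF₂.neg, ← hg.nabla_apply s1.fieldDiffAt hAF₂.neg,
      ← hg.nabla_apply hAF₂.neg s1.fieldDiffAt, hg.nabla_neg hAF₂, e1, e2, map_neg, sub_neg_eq_add]
  -- Substituting F₁ = -A(AF₁) turns the derivative of the section into one of A, up to a term in
  -- the image of A, which is orthogonal to `U`.
  have hF₁ : nabla (inducedForm S i) F₁ x (A x Y)
      = - nabla (inducedForm S i) (fun y => A y (A y (F₁ y))) x (A x Y) := by
    rw [← hg.nabla_neg hAAF₁]
    refine hg.nabla_congr s1.fieldDiffAt ?_ _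
    filter_upwards [hm] with y hy
    rw [nabla_reeb_nabla_reeb S hi hξ hy.1, neg_neg]
  have hθ : ∀ v, normalCovector S i x ν v = inducedForm S i x v U := by
    intro v
    rw [hg.symm, inducedForm_apply, hU]; rfl
  have hAz : ∀ v, inducedForm S i x (A x v) U = 0 := by
    intro v; rw [hA, hAU, map_zero, neg_zero]
  rw [hθ, hbr, hF₁, hg.nabla_endo hAs s2.fieldDiffAt, hg.nabla_endo hAs hAF₁, e1, e2]
  simp only [map_add, map_neg, add_apply, neg_apply, hAz]
  ring

end Reeb

end Hypersurface

/-! ### The Ricci tensor and the Levi form -/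

/-! ### Comparison of traces over orthonormal families -/

section Trace

variable {V : Type*} [AddCommGroup V] [Module ℝ V] {b : LinearMap.BilinForm ℝ V}
  {W : Submodule ℝ V} {ι κ : Type*} [Fintype ι] [Fintype κ] [DecidableEq ι]

/-- The trace over the whole space, when `p`, `q` is an orthonormal basis of `Wᗮ`. -/
lemma sum_orthonormal_eq_add_add (hs : ∀ u v, b u v = b v u) {e : ι → V} {f : κ → V}
    (he : ∀ i j, b (e i) (e j) = if i = j then 1 else 0)
    (hee : ∀ v, v = ∑ i, b v (e i) • e i) (hfW : ∀ j, f j ∈ W)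
    (hff : ∀ v ∈ W, v = ∑ j, b v (f j) • f j) {p q : V} (hp : b p p = 1) (hq : b q q = 1)
    (hpq : b p q = 0) (hW : ∀ v, v ∈ W ↔ b v p = 0 ∧ b v q = 0) (B : LinearMap.BilinForm ℝ V) :
    ∑ i, B (e i) (e i) = ∑ j, B (f j) (f j) + (B p p + B q q) := by
  have hqp : b q p = 0 := (hs q p).trans hpq
  have h := sum_orthonormal_eq hs he (f := Sum.elim f ![p, q]) (fun j => hee _) (fun i => ?_) B
  · rw [← h]
    simp [Fintype.sum_sum_type, Fin.sum_univ_two]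
  · generalize e i = v
    have hv : v - b v p • p - b v q • q ∈ W := by
      rw [hW]
      simp [hp, hq, hpq, hqp]
    have hfp : ∀ j, b p (f j) = 0 := fun j => (hs _ _).trans ((hW _).1 (hfW j)).1
    have hfq : ∀ j, b q (f j) = 0 := fun j => (hs _ _).trans ((hW _).1 (hfW j)).2
    have h1 := hff _ hv
    simp only [map_sub, map_smul, LinearMap.sub_apply, LinearMap.smul_apply, hfp, hfq, smul_zero,
      sub_zero] at h1
    simp only [Fintype.sum_sum_type, Fin.sum_univ_two, Sum.elim_inl, Sum.elim_inr,
      Matrix.cons_val_zero, Matrix.cons_val_one, ← h1]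
    abel

/-- The trace of a bilinear form does not change under an orthogonal complex structure. -/
lemma sum_complexStructure_eq [DecidableEq κ] (hs : ∀ u v, b u v = b v u) {f : κ → V}
    (hf : ∀ i j, b (f i) (f j) = if i = j then 1 else 0) (hfW : ∀ j, f j ∈ W)
    (hff : ∀ v ∈ W, v = ∑ j, b v (f j) • f j) {A : V →ₗ[ℝ] V} (hAW : ∀ v, A v ∈ W)
    (hAA : ∀ v ∈ W, A (A v) = -v) (hA : ∀ v w, b (A v) w = - b v (A w))
    (B : LinearMap.BilinForm ℝ V) :
    ∑ j, B (A (f j)) (A (f j)) = ∑ j, B (f j) (f j) := by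
  -- Only the expansions in the family `A (f j)` have to be checked; they follow by applying A to
  -- the expansion of `A (f i)`.
  refine sum_orthonormal_eq hs hf (f := fun j => A (f j)) (fun j => hff _ (hAW _)) (fun i => ?_) B
  have h := congrArg A (hff _ (hAW (f i)))
  rw [hAA _ (hfW i), map_sum] at h
  rw [← neg_inj, h, ← Finset.sum_neg_distrib]
  exact Finset.sum_congr rfl fun j _ => by rw [map_smul, hA, neg_smul]

end Trace

section Hypersurface

variable {n : ℕ} {M : Type*} [TopologicalSpace M]
  [ChartedSpace (EuclideanSpace ℝ (Fin (2 * n + 1))) M] [IsManifold (𝓡 (2 * n + 1)) ∞ M]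
  {N : Type*} [TopologicalSpace N]
  [ChartedSpace (EuclideanSpace ℝ (Fin (2 * n))) N] [IsManifold (𝓡 (2 * n)) ∞ N]
  (S : SasakianStructure n M) {i : N → M} (hi : IsHypersurface (n := n) i)
  {ξ : Π y : N, TangentSpace (𝓡 (2 * n)) y}
  (hξ : ∀ y : N, mfderiv (𝓡 (2 * n)) (𝓡 (2 * n + 1)) i y (ξ y) = S.ξ (i y))
  {x : N} {ν : TangentSpace (𝓡 (2 * n + 1)) (i x)} {U : TangentSpace (𝓡 (2 * n)) x}
  (hν : ∀ v, S.g.inner (i x) (mfderiv (𝓡 (2 * n)) (𝓡 (2 * n + 1)) i x v) ν = 0)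
  (hU : mfderiv (𝓡 (2 * n)) (𝓡 (2 * n + 1)) i x U = S.φ (i x) ν)
include hi hξ hν hU

lemma nabla_reeb_eq_zero : nabla (inducedForm S i) ξ x U = 0 := by
  refine (isSmoothMetric_inducedForm S hi).ext_inner fun w => ?_
  rw [inner_nabla_reeb S hi hξ, hU, S.φ_sq, η_normal S hi hξ hν, zero_smul, add_zero,
    S.isSmoothMetric.inner_neg_left, S.g.symm, hν, map_zero]
  simp

/-- By skewness of φ, the normal component of φv is -g(v, φν), so tangency of φv is orthogonality to
`U`. -/
lemma mem_holTangent_iff (hν0 : ν ≠ 0) (v : TangentSpace (𝓡 (2 * n)) x) :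
    v ∈ holTangent S i x ↔ inducedForm S i x v (ξ x) = 0 ∧ inducedForm S i x v U = 0 := by
  have h : inducedForm S i x v U
      = - S.g.inner (i x) (S.φ (i x) (mfderiv (𝓡 (2 * n)) (𝓡 (2 * n + 1)) i x v)) ν := by
    rw [inducedForm_apply, hU, S.inner_φ_left, neg_neg]
  constructor
  · rintro ⟨h1, Z, hZ⟩
    refine ⟨by rw [inducedForm_apply, hξ, h1], ?_⟩
    rw [h, ← hZ, hν, neg_zero]
  · rintro ⟨h1, h2⟩
    refine ⟨by rw [← hξ]; exact h1, exists_mfderiv_eq S hi hν0 hν ?_⟩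
    rwa [h, neg_eq_zero] at h2

lemma ricci_eq (hν1 : S.g.inner (i x) ν ν = 1) :
    ricci (𝓡 (2 * n)) (inducedMetric S i) x (ξ x) U
      = (1 / 2) * metricTrace (inducedMetric S i x) (holTangent S i x) (leviForm S i x ν) := by
  have hg := isSmoothMetric_inducedForm S hi
  have hξs := fieldSmoothAt_reeb S hi hξ
  have hA := nabla_reeb_skew S hi hξ
  have hν0 : ν ≠ 0 := by
    rintro rfl
    simp at hν1
  have : FiniteDimensional ℝ (TangentSpace (𝓡 (2 * n)) x) :=
    inferInstanceAs (FiniteDimensional ℝ (EuclideanSpace ℝ (Fin (2 * n))))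
  let g := inducedForm S i
  let A := nabla g ξ
  have hAs : ∀ Z, FieldSmoothAt (𝓡 (2 * n)) Z x →
      FieldSmoothAt (𝓡 (2 * n)) (fun y => A y (Z y)) x :=
    fun Z hZ => hg.fieldSmoothAt_nabla hZ (hξs x)
  let b : LinearMap.BilinForm ℝ (TangentSpace (𝓡 (2 * n)) x) :=
    LinearMap.mk₂ ℝ (fun u v => g x u v) (fun _ _ _ => by simp) (fun _ _ _ => by simp)
      (fun _ _ _ => by simp) (fun _ _ _ => by simp)
  let T : TangentSpace (𝓡 (2 * n)) x →ₗ[ℝ] TangentSpace (𝓡 (2 * n)) x :=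
    (nabla g (fun y => A y (FiberBundle.extend (EuclideanSpace ℝ (Fin (2 * n))) U y)) x
      - (A x).comp (nabla g (FiberBundle.extend (EuclideanSpace ℝ (Fin (2 * n))) U) x)).toLinearMap
  let Q : LinearMap.BilinForm ℝ (TangentSpace (𝓡 (2 * n)) x) := b.comp T LinearMap.id
  have hQ : ∀ v w, Q v w = g x (nablaEnd g A x v U) w := fun _ _ => rfl
  have hskew : ∀ v w, g x (nablaEnd g A x v w) U = - Q v w := by
    intro v w
    rw [hg.nablaEnd_skew hξs hA, hg.symm, hQ]
  -- (∇_ξ A)ξ = ∇_ξ(Aξ) - A(Aξ) vanishes as Aξ = 0. That the zero field has zero derivative is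
  -- obtained by noting that it equals its own negative.
  have hQξ : Q (ξ x) (ξ x) = 0 := by
    have h1 := hg.nabla_endo hAs (hξs x).fieldDiffAt (ξ x)
    have h2 : (fun y => A y (ξ y)) = fun y => - A y (ξ y) := by
      ext1 y
      rw [nabla_reeb_reeb S hi hξ, neg_zero]
    have h3 := hg.nabla_neg (hAs _ (hξs x)).fieldDiffAt (ξ x)
    rw [← h2, h1, nabla_reeb_reeb S hi hξ, map_zero, add_zero] at h3
    have h4 := (congrArg (fun v => g x v U) h3).trans (hg.inner_neg_left _ _)
    have h5 := hskew (ξ x) (ξ x)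
    linarith
  -- A skew endomorphism pairs `U` with its image to zero.
  have hQU : Q U U = 0 := by
    have h := hskew U U
    rw [← hQ] at h
    linarith
  have hmem := mem_holTangent_iff S hi hξ hν hU hν0
  obtain ⟨e, -, he, hee, hR⟩ := exists_metricTrace_eq (b := b) (hg.symm x) (hg.pos x) ⊤
    (fun w z => inducedMetric S i x (curvature (𝓡 (2 * n)) (inducedMetric S i)
      (FiberBundle.extend (EuclideanSpace ℝ (Fin (2 * n))) w)
      (FiberBundle.extend (EuclideanSpace ℝ (Fin (2 * n))) (ξ x))
      (FiberBundle.extend (EuclideanSpace ℝ (Fin (2 * n))) U) x) z)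
  obtain ⟨f, hfW, hf, hff, hL⟩ := exists_metricTrace_eq (b := b) (hg.symm x) (hg.pos x)
    (holTangent S i x) (leviForm S i x ν)
  -- The Ricci tensor uses an arbitrary extension of `ξ x`; `curvature_congr` exchanges it for the
  -- Killing field itself, to which `curvature_killing` applies.
  have hcurv : ∀ w z, inducedMetric S i x (curvature (𝓡 (2 * n)) (inducedMetric S i)
      (FiberBundle.extend (EuclideanSpace ℝ (Fin (2 * n))) w)
      (FiberBundle.extend (EuclideanSpace ℝ (Fin (2 * n))) (ξ x))
      (FiberBundle.extend (EuclideanSpace ℝ (Fin (2 * n))) U) x) z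
      = Q w z := by
    intro w z
    have h1 := hg.curvature_congr (fieldSmoothAt_extend w) (fieldSmoothAt_extend (ξ x)) (hξs x)
      (fieldSmoothAt_extend U) (FiberBundle.extend_apply_self _ _)
    have h2 := hg.curvature_killing hξs hA (fieldSmoothAt_extend w) (fieldSmoothAt_extend U)
    rw [FiberBundle.extend_apply_self, FiberBundle.extend_apply_self] at h2
    exact congrArg (fun v => g x v z) (h1.trans h2)
  have hlevi : ∀ v ∈ holTangent S i x, leviForm S i x ν v v = Q v v + Q (A x v) (A x v) := by
    intro v hv
    rw [leviForm_eq S hi hξ hU (nabla_reeb_eq_zero S hi hξ hν hU) hv hv, hskew, hskew]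
    ring
  have hξξ : b (ξ x) (ξ x) = 1 := by
    change inducedForm S i x (ξ x) (ξ x) = 1
    rw [inducedForm_apply, hξ, S.inner_ξ, S.η_ξ]
  have hUU : b U U = 1 := by
    change inducedForm S i x U U = 1
    rw [inducedForm_apply, hU, S.compatible, hν1, η_normal S hi hξ hν]
    ring
  have hξU : b (ξ x) U = 0 := by
    change inducedForm S i x (ξ x) U = 0
    rw [inducedForm_apply, hξ, hU, S.g.symm, S.inner_ξ, S.η_φ]
  have hsum := sum_orthonormal_eq_add_add (b := b) (hg.symm x) he (fun v => hee v trivial) hfW hff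
    hξξ hUU hξU hmem Q
  have hsumA := sum_complexStructure_eq (b := b) (A := (A x).toLinearMap) (hg.symm x) hf hfW hff
    (nabla_reeb_mem S hi hξ x) (fun v hv => nabla_reeb_nabla_reeb S hi hξ hv) (hA x) Q
  change metricTrace (fun u v => b u v) ⊤ _ = 1 / 2 * metricTrace (fun u v => b u v) _ _
  refine hR.trans ?_
  rw [hL]
  simp only [hcurv]
  rw [hsum, hQξ, hQU, Finset.sum_congr rfl fun j _ => hlevi _ (hfW j), Finset.sum_add_distrib]
  have h : ∑ j, Q (A x (f j)) (A x (f j)) = ∑ j, Q (f j) (f j) := hsumA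
  rw [h]
  ring

end Hypersurface

end SasakiHypersurface

end

theorem mainTheorem3 (n : ℕ)
    {M : Type*} [TopologicalSpace M]
    [ChartedSpace (EuclideanSpace ℝ (Fin (2 * n + 1))) M] [IsManifold (𝓡 (2 * n + 1)) ∞ M]
    (S : SasakiHypersurface.SasakianStructure n M)
    {N : Type*} [TopologicalSpace N]
    [ChartedSpace (EuclideanSpace ℝ (Fin (2 * n))) N] [IsManifold (𝓡 (2 * n)) ∞ N]
    (i : N → M) (hi : SasakiHypersurface.IsHypersurface (n := n) i)
    (hξ : ∀ y : N, ∃ u : TangentSpace (𝓡 (2 * n)) y,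
      mfderiv (𝓡 (2 * n)) (𝓡 (2 * n + 1)) i y u = S.ξ (i y))
    (x : N) (ν : TangentSpace (𝓡 (2 * n + 1)) (i x))
    (hν_unit : S.g.inner (i x) ν ν = 1)
    (hν_normal : ∀ v : TangentSpace (𝓡 (2 * n)) x,
      S.g.inner (i x) (mfderiv (𝓡 (2 * n)) (𝓡 (2 * n + 1)) i x v) ν = 0) :
    ∃ u w : TangentSpace (𝓡 (2 * n)) x,
      mfderiv (𝓡 (2 * n)) (𝓡 (2 * n + 1)) i x u = S.ξ (i x) ∧
      mfderiv (𝓡 (2 * n)) (𝓡 (2 * n + 1)) i x w = S.φ (i x) ν ∧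
      SasakiHypersurface.ricci (𝓡 (2 * n)) (SasakiHypersurface.inducedMetric S i) x u w =
        (1 / 2) * SasakiHypersurface.metricTrace (SasakiHypersurface.inducedMetric S i x)
          (SasakiHypersurface.holTangent S i x) (SasakiHypersurface.leviForm S i x ν) := by
  -- By injectivity of the differential the two tangent vectors asserted to exist are the only ones
  -- with these images, so the existential form loses nothing.
  choose ξ hξ' using hξ
  have hν0 : ν ≠ 0 := by
    rintro rfl
    simp at hν_unit
  obtain ⟨U, hU⟩ := SasakiHypersurface.exists_mfderiv_eq_φ S hi hν0 hν_normal
  exact ⟨ξ x, U, hξ' x, hU, SasakiHypersurface.ricci_eq S hi hξ' hν_normal hU hν_unit⟩
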